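/- **Biasing normal coin-flipping protocols.** All logarithms are to base $2$. For an integer $n\ge 3$ put $\varepsilon=\varepsilon(n)=1/(\log\log n)^{1/50}$, $\lambda=100/\varepsilon^{5}$ and $\delta=1/\log^{2}n$. *Protocols.* A $t$-party, $\ell$-round full-information coin-flipping protocol $\Pi$ is stateless: in each round $i\in[\ell]$ the messages $m_{<i}$ sent so far determine the single party $\mathsf{party}(m_{<i})\in[t]$ that speaks and the (discrete) distribution of the message it broadcasts; the common output is a deterministic Boolean function of the full transcript. Let $M$ be the transcript of an honest execution, let $\Pi(m_{\le i})$ be the expected output given that $M_{\le i}=m_{\le i}$, and let $\mathbb E[\Pi]$ be the expected output. Put $\mathrm{jump}(m_{\le i})=\Pi(m_{\le i})-\Pi(m_{<i})$ and $v_i(m)=\mathrm{Var}[\mathrm{jump}(M_{\le i})\mid M_{<i}=m_{<i}]$. For a party $P$ and a transcript $m$ let $\mathrm{Idx}_P(m)=\{i\in[\ell]:\mathsf{party}(m_{<i})=P\}$. *Normal protocols.* $\Pi$ is $n$-normal with special party $\mathrm{NonRobust}\in[t]$ if for every $m\in\mathrm{Supp}(M)$: 1. for every $i\in[\ell]$,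 the support of $\mathrm{jump}(M_{\le i})$ conditioned on $M_{<i}=m_{<i}$ meets $(-\infty,-\frac1{\lambda\sqrt n}]$ if and only if $i\in\mathrm{Idx}_{\mathrm{NonRobust}}(m)$; 2. every party $P\ne\mathrm{NonRobust}$ that has a large jump in $m$, i.e. $v_i(m)\ge\frac1{\lambda n}$ for some $i\in\mathrm{Idx}_P(m)$, satisfies $|\mathrm{Idx}_P(m)|=1$; 3. every small-jumps party $P$ in $m$, i.e. $P\neq\mathrm{NonRobust}$ with $\mathrm{Idx}_P(m)\ne\emptyset$ and no large jump in $m$, satisfies $\sum_{i\in\mathrm{Idx}_P(m)}v_i(m)\le\frac{2}{\lambda n}$; 4. at most $n$ small-jumps parties $P$ in $m$ satisfy $\sum_{i\in\mathrm{Idx}_P(m)}v_i(m)<\frac1{\lambda n}$. *Adversaries.* A $k$-adaptive adversary for $\Pi$ is a (randomized, computationally unbounded) strategy that, before each round, given everything it has seen so far, may add the party about to speak to its list of corrupted parties, which never has more than $k$ members; whenever the speaker is corrupted, the adversary chooses its message freely within the support of the honest distribution of that message. Parties that are not corrupted follow $\Pi$. Let $\mathbb E[\Pi_A]$ be the expected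 output of $\Pi$ under the attack of $A$. **Statement.** There are absolute constants $C_1,C_2>0$ such that the following holds for every $n\ge3$. Let $\Pi$ be a full-information coin-flipping protocol, with any numbers of parties and rounds, that is $n$-normal with special party $\mathrm{NonRobust}$. If $\mathbb E[\Pi]\ge\varepsilon$ and $\Pr[\mathrm{Idx}_{\mathrm{NonRobust}}(M)\neq\emptyset]\le\delta$, then for some integer $k\le C_1\sqrt n\,\log n$ there is a $k$-adaptive adversary $A$ for $\Pi$ with $\mathbb E[\Pi_A]\ge 1-C_2\,\varepsilon$. -/

import Mathlib

namespace CoinFlip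

/-- The error parameter `1 / (log log n)^(1/50)`, logarithms to base `2`. -/
noncomputable def eps (n : ℕ) : ℝ :=
  1 / (Real.logb 2 (Real.logb 2 (n : ℝ))) ^ (1 / 50 : ℝ)

/-- The parameter `100 / eps ^ 5`. -/
noncomputable def lam (n : ℕ) : ℝ := 100 / (eps n) ^ 5

/-- The parameter `1 / log ^ 2 n`, logarithm to base `2`. -/
noncomputable def del (n : ℕ) : ℝ := 1 / (Real.logb 2 (n : ℝ)) ^ 2

/-- The probability of an event under a discrete distribution, as a real number. -/
noncomputable def pr {α : Type*} (p : PMF α) (S : Set α) : ℝ := (p.toOuterMeasure S).toReal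

/-- A `t`-party, `l`-round, stateless full-information coin-flipping protocol with messages in `M`.
A history is the list, in chronological order, of the messages sent so far; it determines who
speaks next and the law of the next message.  The common output is a deterministic Boolean function
of the full transcript.  (Only histories of length `< l` matter for `party` and `msg`, and only
lists of length `l` matter for `outcome`.) -/
structure Protocol (M : Type*) (t l : ℕ) where
  party : List M → Fin t
  msg : List M → PMF M
  outcome : List M → Bool

namespace Protocol

variable {M : Type*} {t l : ℕ}

/-- The law of the history after `k` more honest rounds, given that the history is now `h`. -/
noncomputable def extend (Pi : Protocol M t l) : ℕ → List M → PMF (List M)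
  | 0, h => PMF.pure h
  | k + 1, h => (Pi.msg h).bind fun m => extend Pi k (h ++ [m])

/-- The law of the transcript of an honest execution. -/
noncomputable def transcript (Pi : Protocol M t l) : PMF (List M) := Pi.extend l []

/-- The expected outcome given the partial transcript `h` (of length at most `l`): the probability
that the outcome is `1` when the execution is honestly continued from `h`. -/
noncomputable def value (Pi : Protocol M t l) (h : List M) : ℝ :=
  pr (Pi.extend (l - h.length) h) {w | Pi.outcome w = true}

/-- The expected outcome of the protocol. -/
noncomputable def expectation (Pi : Protocol M t l) : ℝ := Pi.value []

/-- The change in expected outcome when `m` is sent after the history `h`. -/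
noncomputable def jump (Pi : Protocol M t l) (h : List M) (m : M) : ℝ :=
  Pi.value (h ++ [m]) - Pi.value h

/-- The conditional support of the jump caused by the next message, given the history `h`. -/
def jumpSupport (Pi : Protocol M t l) (h : List M) : Set ℝ :=
  Pi.jump h '' (Pi.msg h).support

/-- The conditional variance of the jump caused by the next message, given the history `h`
(every set of messages is measurable, as distributions are discrete). -/
noncomputable def jumpVar (Pi : Protocol M t l) (h : List M) : ℝ :=
  letI : MeasurableSpace M := ⊤
  ProbabilityTheory.variance (Pi.jump h) (Pi.msg h).toMeasure

/-- The rounds (numbered from `0`) in which party `P` speaks in the transcript `w`.  The history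
before round `i` is `w.take i`. -/
def idx (Pi : Protocol M t l) (P : Fin t) (w : List M) : Finset ℕ :=
  (Finset.range l).filter fun i => Pi.party (w.take i) = P

/-- The sum of the conditional variances of the jumps of party `P` along the transcript `w`. -/
noncomputable def totalVar (Pi : Protocol M t l) (P : Fin t) (w : List M) : ℝ :=
  ∑ i ∈ Pi.idx P w, Pi.jumpVar (w.take i)

/-- `P`, different from the special party `NR`, has a large jump in the transcript `w`. -/
def LargeJump (Pi : Protocol M t l) (n : ℕ) (NR P : Fin t) (w : List M) : Prop :=
  P ≠ NR ∧ ∃ i ∈ Pi.idx P w, 1 / (lam n * n) ≤ Pi.jumpVar (w.take i)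

/-- `P`, different from the special party `NR`, participates but has no large jump in `w`. -/
def SmallJumps (Pi : Protocol M t l) (n : ℕ) (NR P : Fin t) (w : List M) : Prop :=
  P ≠ NR ∧ (Pi.idx P w).Nonempty ∧ ¬ Pi.LargeJump n NR P w

/-- `P` is a small-jumps party of small overall variance in `w`. -/
def Unfulfilled (Pi : Protocol M t l) (n : ℕ) (NR P : Fin t) (w : List M) : Prop :=
  Pi.SmallJumps n NR P w ∧ Pi.totalVar P w < 1 / (lam n * n)

/-- The protocol is `n`-normal, with `NR` in the role of the party `NonRobust`. -/
structure IsNormal (Pi : Protocol M t l) (n : ℕ) (NR : Fin t) : Prop where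
  single_nonRobust : ∀ w ∈ Pi.transcript.support, ∀ i < l,
    (Pi.jumpSupport (w.take i) ∩ Set.Iic (-(1 / (lam n * Real.sqrt n)))).Nonempty ↔
      i ∈ Pi.idx NR w
  large_single_message : ∀ w ∈ Pi.transcript.support, ∀ P : Fin t,
    Pi.LargeJump n NR P w → (Pi.idx P w).card = 1
  small_bounded_variance : ∀ w ∈ Pi.transcript.support, ∀ P : Fin t,
    Pi.SmallJumps n NR P w → Pi.totalVar P w ≤ 2 * (1 / (lam n * n))
  unfulfilled_le : ∀ w ∈ Pi.transcript.support,
    {P : Fin t | Pi.Unfulfilled n NR P w}.ncard ≤ n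

end Protocol

/-- What the adversary has seen so far: for each past round, in chronological order, whether the
speaker was on the list of corrupted parties in that round, and the message sent. -/
abbrev View (M : Type*) := List (Bool × M)

/-- The public history contained in a view. -/
def View.history {M : Type*} (v : View M) : List M := v.map Prod.snd

/-- A (randomized, computationally unbounded) adaptive adversary.  Before each round it decides, at
random given its view, whether to add the party about to speak to the list of corrupted parties
(`corrupt`; irrelevant if that party is already corrupted).  If the speaker is corrupted, the
adversary chooses the message, again at random given its view (`send`); it may only send messages
that an honest party could send at this point. -/
structure Adversary {M : Type*} {t l : ℕ} (Pi : Protocol M t l) where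
  corrupt : View M → PMF Bool
  send : View M → PMF M
  send_valid : ∀ v : View M, (send v).support ⊆ (Pi.msg v.history).support

namespace Protocol

variable {M : Type*} {t l : ℕ}

/-- The parties that are on the list of corrupted parties after the rounds recorded in `v`. -/
def corrupted (Pi : Protocol M t l) (v : View M) : Set (Fin t) :=
  {P | ∃ (i : ℕ) (hi : i < v.length), v[i].1 = true ∧ Pi.party (v.history.take i) = P}

end Protocol

namespace Adversary

variable {M : Type*} {t l : ℕ} {Pi : Protocol M t l}

open Classical in
/-- One round of the attacked execution. -/
noncomputable def step (A : Adversary Pi) (v : View M) : PMF (Bool × M) :=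
  (if Pi.party v.history ∈ Pi.corrupted v then PMF.pure true else A.corrupt v).bind fun b =>
    (if b then A.send v else Pi.msg v.history).map fun m => (b, m)

/-- The law of the view after `k` more rounds of the attacked execution, from the view `v` on. -/
noncomputable def run (A : Adversary Pi) : ℕ → View M → PMF (View M)
  | 0, v => PMF.pure v
  | k + 1, v => (A.step v).bind fun e => run A k (v ++ [e])

/-- The law of the adversary's view of a full attacked execution. -/
noncomputable def execution (A : Adversary Pi) : PMF (View M) := A.run l []

/-- The adversary is `k`-adaptive: it never has more than `k` parties on its list. -/
def IsAdaptive (A : Adversary Pi) (k : ℕ) : Prop :=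
  ∀ v ∈ A.execution.support, (Pi.corrupted v).ncard ≤ k

/-- The expected outcome of the protocol under attack. -/
noncomputable def expectation (A : Adversary Pi) : ℝ :=
  pr A.execution {v | Pi.outcome v.history = true}

end Adversary

end CoinFlip

/-! The attack gives every message of an ordinary party the public law with density `1 + κ * jump`
with respect to the honest one. Since `1 + x ≤ exp x`, the process `exp (-κ * value)` is then a
supermartingale, so without a budget the outcome is `0` with probability at most `exp (-κ *
Pi.expectation)`. The special party always sends a message with nonnegative jump, which only helps.

Such a public law does not require corrupting every speaker. If, given the public history, the
speaker is corrupted with probability `ρ`, it suffices that it uses the density `1 + κ / ρ * jump`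
when corrupted. Normality bounds the jumps below by `-a`, so this is a density as soon as `ρ ≥ f`
and `κ * a ≤ f / 2`. Hence a speaker whose conditional probability `π` of being corrupted is below
`f` is recruited just often enough to raise it to `f`.

It remains to bound the number of corruptions. Given the public history, the memberships of the
parties in the corrupted set are independent, so the expected size of this set is the sum of the
`π`, and each `π` moves by Bayes' rule. Put `G π = π ^ 2 / (2 * f) - π`. It is minimal at `f`, so
recruitment does not increase it, and a Bayes update increases its mean by at most `κ ^ 2 / f` times
the variance of the jump. At the end `π ≤ G π + 2 * f`, and the number of participating ordinary
parties is at most `n` plus the overall variance divided by `1 / (lam n * n)`. Both variance terms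
are paid for by the drift of the value: it grows in mean by `κ` times the variance and never exceeds
`1`.

`potential` combines these accounts. `potential_le_of_ordinary` and `potential_le_of_special` show
that it is a supermartingale, `cost_le_potential` that it bounds the final cost, `sum_loss_le`
carries the bound back to the start, and `ex_run_attack_le` passes to the attack with a budget. -/

namespace CoinFlip

/-! ### Expectations under discrete distributions -/

section Expectation

variable {α β : Type*}

/-- The expectation of a real function under a discrete distribution. -/
noncomputable def ex (p : PMF α) (f : α → ℝ) : ℝ := ∑' a, (p a).toReal * f a

/-- The function is bounded on the support of the distribution. -/
def Bdd (p : PMF α) (f : α → ℝ) : Prop := ∃ C, ∀ a ∈ p.support, |f a| ≤ C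

theorem hasSum_toReal (p : PMF α) : HasSum (fun a => (p a).toReal) 1 := by
  have h := ENNReal.summable_toReal (p.tsum_coe_ne_top)
  have h2 : ∑' a, (p a).toReal = 1 := by
    rw [← ENNReal.tsum_toReal_eq (fun a => p.apply_ne_top a), p.tsum_coe, ENNReal.toReal_one]
  rw [← h2]
  exact h.hasSum

theorem toReal_eq_zero {p : PMF α} {a : α} (h : a ∉ p.support) : (p a).toReal = 0 := by
  rw [(p.apply_eq_zero_iff a).2 h, ENNReal.toReal_zero]

theorem toReal_pos {p : PMF α} {a : α} (h : a ∈ p.support) : 0 < (p a).toReal :=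
  ENNReal.toReal_pos ((p.mem_support_iff a).1 h) (p.apply_ne_top a)

theorem Bdd.summable {p : PMF α} {f : α → ℝ} (h : Bdd p f) :
    Summable fun a => (p a).toReal * f a := by
  obtain ⟨C, hC⟩ := h
  refine Summable.of_norm_bounded ((hasSum_toReal p).summable.mul_right C) fun a => ?_
  by_cases ha : a ∈ p.support
  · rw [Real.norm_eq_abs, abs_mul, abs_of_nonneg ENNReal.toReal_nonneg]
    exact mul_le_mul_of_nonneg_left (hC a ha) ENNReal.toReal_nonneg
  · simp [toReal_eq_zero ha]

theorem Bdd.const (p : PMF α) (c : ℝ) : Bdd p fun _ => c := ⟨|c|, fun _ _ => le_rfl⟩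

theorem Bdd.of_mem_Icc {p : PMF α} {f : α → ℝ} {C : ℝ} (h : ∀ a, 0 ≤ f a ∧ f a ≤ C) :
    Bdd p f :=
  ⟨C, fun a _ => by rw [abs_of_nonneg (h a).1]; exact (h a).2⟩

theorem Bdd.mono {p : PMF α} {f g : α → ℝ} (hg : Bdd p g) (h : ∀ a ∈ p.support, |f a| ≤ |g a|) :
    Bdd p f :=
  hg.imp fun _ hC a ha => (h a ha).trans (hC a ha)

theorem Bdd.add {p : PMF α} {f g : α → ℝ} (hf : Bdd p f) (hg : Bdd p g) :
    Bdd p fun a => f a + g a := by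
  obtain ⟨C, hC⟩ := hf
  obtain ⟨D, hD⟩ := hg
  exact ⟨C + D, fun a ha => (abs_add_le _ _).trans (add_le_add (hC a ha) (hD a ha))⟩

theorem Bdd.mul {p : PMF α} {f g : α → ℝ} (hf : Bdd p f) (hg : Bdd p g) :
    Bdd p fun a => f a * g a := by
  obtain ⟨C, hC⟩ := hf
  obtain ⟨D, hD⟩ := hg
  refine ⟨C * D, fun a ha => ?_⟩
  rw [abs_mul]
  exact mul_le_mul (hC a ha) (hD a ha) (abs_nonneg _) ((abs_nonneg _).trans (hC a ha))

theorem Bdd.sum {ι : Type*} (s : Finset ι) {p : PMF α} {f : ι → α → ℝ} (hf : ∀ i, Bdd p (f i)) :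
    Bdd p fun a => ∑ i ∈ s, f i a := by
  classical
  induction s using Finset.induction_on with
  | empty => simpa using Bdd.const p 0
  | insert i s hi ih =>
    simp only [Finset.sum_insert hi]
    exact (hf i).add ih

theorem ex_const (p : PMF α) (c : ℝ) : (ex p fun _ => c) = c := by
  rw [ex, tsum_mul_right, (hasSum_toReal p).tsum_eq, one_mul]

theorem ex_add {p : PMF α} {f g : α → ℝ} (hf : Bdd p f) (hg : Bdd p g) :
    (ex p fun a => f a + g a) = ex p f + ex p g := by
  simp only [ex, mul_add]
  exact hf.summable.tsum_add hg.summable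

theorem ex_const_mul (p : PMF α) (c : ℝ) (f : α → ℝ) : (ex p fun a => c * f a) = c * ex p f := by
  simp only [ex, ← tsum_mul_left]
  exact tsum_congr fun a => by ring

theorem ex_congr {p : PMF α} {f g : α → ℝ} (h : ∀ a ∈ p.support, f a = g a) : ex p f = ex p g := by
  refine tsum_congr fun a => ?_
  by_cases ha : a ∈ p.support
  · rw [h a ha]
  · simp [toReal_eq_zero ha]

theorem ex_mono {p : PMF α} {f g : α → ℝ} (hf : Bdd p f) (hg : Bdd p g)
    (h : ∀ a ∈ p.support, f a ≤ g a) : ex p f ≤ ex p g := by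
  refine hf.summable.tsum_le_tsum (fun a => ?_) hg.summable
  by_cases ha : a ∈ p.support
  · exact mul_le_mul_of_nonneg_left (h a ha) ENNReal.toReal_nonneg
  · simp [toReal_eq_zero ha]

theorem ex_nonneg {p : PMF α} {f : α → ℝ} (h : ∀ a, 0 ≤ f a) : 0 ≤ ex p f :=
  tsum_nonneg fun a => mul_nonneg ENNReal.toReal_nonneg (h a)

theorem ex_le_of_le {p : PMF α} {f : α → ℝ} {C : ℝ} (hf : Bdd p f)
    (h : ∀ a ∈ p.support, f a ≤ C) : ex p f ≤ C :=
  (ex_mono hf (Bdd.const p C) h).trans_eq (ex_const p C)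

theorem le_ex_of_le {p : PMF α} {f : α → ℝ} {C : ℝ} (hf : Bdd p f)
    (h : ∀ a ∈ p.support, C ≤ f a) : C ≤ ex p f :=
  (ex_const p C).symm.trans_le (ex_mono (Bdd.const p C) hf h)

theorem ex_sum {ι : Type*} (s : Finset ι) {p : PMF α} {f : ι → α → ℝ} (hf : ∀ i, Bdd p (f i)) :
    (ex p fun a => ∑ i ∈ s, f i a) = ∑ i ∈ s, ex p (f i) := by
  simp only [ex, Finset.mul_sum]
  exact Summable.tsum_finsetSum fun i _ => (hf i).summable

theorem ex_pure (a : α) (f : α → ℝ) : ex (PMF.pure a) f = f a := by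
  rw [ex, tsum_eq_single a]
  · simp
  · intro b hb
    simp [hb]

theorem ofReal_ex {p : PMF α} {f : α → ℝ} {C : ℝ} (h : ∀ a, 0 ≤ f a ∧ f a ≤ C) :
    ENNReal.ofReal (ex p f) = ∑' a, p a * ENNReal.ofReal (f a) := by
  rw [ex, ENNReal.ofReal_tsum_of_nonneg
    (fun a => mul_nonneg ENNReal.toReal_nonneg (h a).1) (Bdd.of_mem_Icc h).summable]
  refine tsum_congr fun a => ?_
  rw [ENNReal.ofReal_mul ENNReal.toReal_nonneg, ENNReal.ofReal_toReal (p.apply_ne_top a)]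

theorem ex_mem_Icc {p : PMF α} {f : α → ℝ} {C : ℝ} (h : ∀ a, 0 ≤ f a ∧ f a ≤ C) :
    0 ≤ ex p f ∧ ex p f ≤ C :=
  ⟨ex_nonneg fun a => (h a).1, ex_le_of_le (Bdd.of_mem_Icc h) fun a _ => (h a).2⟩

/-- For nonnegative functions the exchange of sums takes place in `ENNReal`, where it needs no
summability. -/
theorem ex_bind {p : PMF α} {q : α → PMF β} {f : β → ℝ} {C : ℝ} (h : ∀ b, 0 ≤ f b ∧ f b ≤ C) :
    ex (p.bind q) f = ex p fun a => ex (q a) f := by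
  have h2 : ∀ a, 0 ≤ ex (q a) f ∧ ex (q a) f ≤ C := fun a => ex_mem_Icc h
  rw [← ENNReal.ofReal_eq_ofReal_iff (ex_mem_Icc h).1 (ex_mem_Icc h2).1, ofReal_ex h, ofReal_ex h2]
  simp only [ofReal_ex h, PMF.bind_apply, ← ENNReal.tsum_mul_left, ← ENNReal.tsum_mul_right]
  rw [ENNReal.tsum_comm]
  simp only [mul_assoc]

theorem ex_map {p : PMF α} {g : α → β} {f : β → ℝ} {C : ℝ} (h : ∀ b, 0 ≤ f b ∧ f b ≤ C) :
    ex (p.map g) f = ex p fun a => f (g a) := by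
  rw [PMF.map, ex_bind h]
  simp only [Function.comp, ex_pure]

open Classical in
theorem pr_eq_ex (p : PMF α) (S : Set α) : pr p S = ex p fun a => if a ∈ S then 1 else 0 := by
  rw [pr, PMF.toOuterMeasure_apply, ENNReal.tsum_toReal_eq, ex]
  · refine tsum_congr fun a => ?_
    by_cases ha : a ∈ S <;> simp [ha]
  · intro a
    by_cases ha : a ∈ S <;> simp [ha, p.apply_ne_top]

/-- The distribution with the given real weights. -/
noncomputable def ofWeights (w : α → ℝ) (hw : ∀ a, 0 ≤ w a) (h : HasSum w 1) : PMF α :=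
  ⟨fun a => ENNReal.ofReal (w a), by
    have := ENNReal.ofReal_tsum_of_nonneg hw h.summable
    rw [h.tsum_eq, ENNReal.ofReal_one] at this
    rw [this]
    exact ENNReal.summable.hasSum⟩

theorem ofWeights_toReal (w : α → ℝ) (hw : ∀ a, 0 ≤ w a) (h : HasSum w 1) (a : α) :
    (ofWeights w hw h a).toReal = w a :=
  ENNReal.toReal_ofReal (hw a)

theorem hasSum_coin (r : ℝ) : HasSum (fun b : Bool => if b then r else 1 - r) 1 := by
  convert hasSum_fintype (fun b : Bool => if b then r else 1 - r) using 1
  simp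

/-- A coin showing `true` with probability `r`, truncated to the unit interval. -/
noncomputable def coin (r : ℝ) : PMF Bool :=
  ofWeights _ (fun b => by
    have : 0 ≤ max 0 (min 1 r) ∧ max 0 (min 1 r) ≤ 1 :=
      ⟨le_max_left _ _, max_le zero_le_one (min_le_left _ _)⟩
    cases b <;> simp [this]) (hasSum_coin (max 0 (min 1 r)))

theorem ex_coin {r : ℝ} (h0 : 0 ≤ r) (h1 : r ≤ 1) (f : Bool → ℝ) :
    ex (coin r) f = (1 - r) * f false + r * f true := by
  rw [ex, tsum_fintype, Fintype.sum_bool, coin, ofWeights_toReal, ofWeights_toReal,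
    min_eq_right h1, max_eq_right h0]
  simp only [if_true, Bool.false_eq_true, if_false]
  ring

/-- The distribution `p` reweighted by the density `g`, or `p` itself if `g` is not a density. -/
noncomputable def reweight (p : PMF α) (g : α → ℝ) : PMF α :=
  open Classical in
  if h : (∀ a, 0 ≤ (p a).toReal * g a) ∧ HasSum (fun a => (p a).toReal * g a) 1 then
    ofWeights _ h.1 h.2 else p

theorem support_reweight_subset (p : PMF α) (g : α → ℝ) : (reweight p g).support ⊆ p.support := by
  intro a ha
  by_contra hn
  unfold reweight at ha
  split_ifs at ha with h
  · have := toReal_pos ha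
    rw [ofWeights_toReal, toReal_eq_zero hn, zero_mul] at this
    exact lt_irrefl _ this
  · exact hn ha

theorem reweight_toReal {p : PMF α} {g : α → ℝ} (hg : ∀ a ∈ p.support, 0 ≤ g a)
    (hb : Bdd p g) (h1 : ex p g = 1) (a : α) :
    (reweight p g a).toReal = (p a).toReal * g a := by
  have h : (∀ a, 0 ≤ (p a).toReal * g a) ∧ HasSum (fun a => (p a).toReal * g a) 1 := by
    refine ⟨fun a => ?_, h1 ▸ hb.summable.hasSum⟩
    by_cases ha : a ∈ p.support
    · exact mul_nonneg ENNReal.toReal_nonneg (hg a ha)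
    · simp [toReal_eq_zero ha]
  rw [reweight, dif_pos h, ofWeights_toReal]

theorem ex_reweight {p : PMF α} {g : α → ℝ} (hg : ∀ a ∈ p.support, 0 ≤ g a)
    (hb : Bdd p g) (h1 : ex p g = 1) (f : α → ℝ) :
    ex (reweight p g) f = ex p fun a => g a * f a :=
  tsum_congr fun a => by rw [reweight_toReal hg hb h1, mul_assoc]

theorem exists_nonneg_of_ex_eq_zero {p : PMF α} {f : α → ℝ} (hb : Bdd p f) (h : ex p f = 0) :
    ∃ a ∈ p.support, 0 ≤ f a := by
  by_contra! hc
  obtain ⟨a, ha⟩ := p.support_nonempty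
  have hle : ∀ b, (p b).toReal * f b ≤ 0 := fun b => by
    by_cases hb : b ∈ p.support
    · exact mul_nonpos_of_nonneg_of_nonpos ENNReal.toReal_nonneg (hc b hb).le
    · simp [toReal_eq_zero hb]
  have h1 : ex p f < ex p fun _ => 0 := by
    refine Summable.tsum_lt_tsum (i := a) (fun b => by simpa using hle b) ?_ hb.summable
      (Bdd.const p 0).summable
    simpa using mul_neg_of_pos_of_neg (toReal_pos ha) (hc a ha)
  rw [ex_const, h] at h1
  exact lt_irrefl _ h1

theorem variance_eq_ex {p : PMF α} {f : α → ℝ} (hb : Bdd p f) (h : ex p f = 0) :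
    letI : MeasurableSpace α := ⊤
    ProbabilityTheory.variance f p.toMeasure = ex p fun a => f a ^ 2 := by
  let _ : MeasurableSpace α := ⊤
  have key : ∀ g : α → ℝ, Bdd p g → ∫ a, g a ∂p.toMeasure = ex p g := by
    rintro g ⟨C, hC⟩
    rw [PMF.integral_eq_tsum]
    · rfl
    · refine MeasureTheory.Integrable.of_bound (measurable_from_top.aestronglyMeasurable) C ?_
      rw [← p.restrict_toMeasure_support]
      exact MeasureTheory.ae_restrict_of_forall_mem MeasurableSpace.measurableSet_top
        fun a ha => hC a ha
  rw [ProbabilityTheory.variance_of_integral_eq_zero measurable_from_top.aemeasurable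
    ((key f hb).trans h)]
  refine (key (fun a => f a ^ 2) ?_)
  simpa only [sq] using hb.mul hb

/-- Comparison of expectations under a mixture of two distributions. -/
theorem mix_le {p q : PMF α} {r : ℝ} {f g u : α → ℝ} (hf : Bdd p f) (hg : Bdd q g)
    (hp : Bdd p u) (hq : Bdd q u)
    (h : ∀ a, (1 - r) * (p a).toReal * f a + r * (q a).toReal * g a ≤
      ((1 - r) * (p a).toReal + r * (q a).toReal) * u a) :
    (1 - r) * ex p f + r * ex q g ≤ (1 - r) * ex p u + r * ex q u := by
  simp only [ex, ← tsum_mul_left]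
  rw [← (hf.summable.mul_left _).tsum_add (hg.summable.mul_left _),
    ← (hp.summable.mul_left _).tsum_add (hq.summable.mul_left _)]
  refine ((hf.summable.mul_left _).add (hg.summable.mul_left _)).tsum_le_tsum (fun a => ?_)
    ((hp.summable.mul_left _).add (hq.summable.mul_left _))
  linarith [h a]

end Expectation

/-! ### The value martingale, reachable histories, consequences of normality -/

namespace Protocol

variable {M : Type*} {t l : ℕ} {Pi : Protocol M t l}

open Classical in
theorem value_eq_ex_extend (Pi : Protocol M t l) (h : List M) :
    Pi.value h =
      ex (Pi.extend (l - h.length) h) fun w => if Pi.outcome w = true then 1 else 0 := by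
  rw [value, pr_eq_ex]
  refine ex_congr fun w _ => ?_
  simp only [Set.mem_ofPred_eq]
  congr

theorem ite_mem_Icc (c : Prop) [Decidable c] :
    (0 : ℝ) ≤ (if c then 1 else 0) ∧ (if c then (1 : ℝ) else 0) ≤ 1 := by
  split_ifs <;> simp

theorem value_mem_Icc (Pi : Protocol M t l) (h : List M) :
    0 ≤ Pi.value h ∧ Pi.value h ≤ 1 := by
  classical
  rw [value_eq_ex_extend]
  exact ex_mem_Icc fun a => ite_mem_Icc _

theorem value_of_length_eq {h : List M} (hl : h.length = l) :
    Pi.value h = if Pi.outcome h = true then 1 else 0 := by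
  classical
  rw [value_eq_ex_extend, hl, Nat.sub_self, extend, ex_pure]

theorem ex_value {h : List M} (hl : h.length < l) :
    (ex (Pi.msg h) fun m => Pi.value (h ++ [m])) = Pi.value h := by
  classical
  obtain ⟨k, hk⟩ : ∃ k, l - h.length = k + 1 := ⟨l - h.length - 1, by omega⟩
  rw [value_eq_ex_extend, hk, extend, ex_bind (C := 1) fun a => ite_mem_Icc _]
  refine ex_congr fun m _ => ?_
  rw [value_eq_ex_extend]
  congr
  simp only [List.length_append, List.length_singleton]
  omega

theorem abs_jump_le (Pi : Protocol M t l) (h : List M) (m : M) : |Pi.jump h m| ≤ 1 := by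
  have h1 := Pi.value_mem_Icc h
  have h2 := Pi.value_mem_Icc (h ++ [m])
  rw [jump, abs_le]
  constructor <;> linarith

theorem bdd_jump (Pi : Protocol M t l) (h : List M) : Bdd (Pi.msg h) (Pi.jump h) :=
  ⟨1, fun m _ => Pi.abs_jump_le h m⟩

theorem ex_jump {h : List M} (hl : h.length < l) : ex (Pi.msg h) (Pi.jump h) = 0 := by
  have : Pi.jump h = fun m => Pi.value (h ++ [m]) + -Pi.value h := by
    ext m
    rw [jump, sub_eq_add_neg]
  rw [this, ex_add (Bdd.of_mem_Icc (C := 1) fun m => Pi.value_mem_Icc _) (Bdd.const _ _), ex_value hl,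
    ex_const, add_neg_cancel]

theorem jumpVar_eq_ex {h : List M} (hl : h.length < l) :
    Pi.jumpVar h = ex (Pi.msg h) fun m => Pi.jump h m ^ 2 :=
  variance_eq_ex (Pi.bdd_jump h) (ex_jump hl)

theorem jumpVar_nonneg (Pi : Protocol M t l) (h : List M) : 0 ≤ Pi.jumpVar h :=
  ProbabilityTheory.variance_nonneg _ _

/-- The history occurs with positive probability in an honest execution. -/
def Reachable (Pi : Protocol M t l) (h : List M) : Prop := h ∈ (Pi.extend h.length []).support

theorem extend_add (Pi : Protocol M t l) (a b : ℕ) (h : List M) :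
    Pi.extend (a + b) h = (Pi.extend a h).bind (Pi.extend b) := by
  induction a generalizing h with
  | zero => rw [Nat.zero_add, extend, PMF.pure_bind]
  | succ a ih =>
    rw [Nat.succ_add, extend, extend, PMF.bind_bind]
    congr 1
    ext1 m
    exact ih _

theorem exists_of_mem_support_extend {k : ℕ} {h w : List M} (hw : w ∈ (Pi.extend k h).support) :
    ∃ s : List M, w = h ++ s ∧ s.length = k := by
  induction k generalizing h with
  | zero =>
    rw [extend, PMF.mem_support_pure_iff] at hw
    exact ⟨[], by simp [hw]⟩
  | succ k ih =>
    rw [extend, PMF.mem_support_bind_iff] at hw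
    obtain ⟨m, -, hm⟩ := hw
    obtain ⟨s, hs, hk⟩ := ih hm
    exact ⟨m :: s, by simp [hs], by simp [hk]⟩

theorem reachable_nil (Pi : Protocol M t l) : Pi.Reachable [] := by
  rw [Reachable, List.length_nil, extend, PMF.mem_support_pure_iff]

theorem Reachable.append {h : List M} (hr : Pi.Reachable h) {m : M}
    (hm : m ∈ (Pi.msg h).support) : Pi.Reachable (h ++ [m]) := by
  rw [Reachable, List.length_append, List.length_singleton, extend_add, PMF.mem_support_bind_iff]
  refine ⟨h, hr, ?_⟩
  rw [extend, PMF.mem_support_bind_iff]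
  exact ⟨m, hm, by rw [extend, PMF.mem_support_pure_iff]⟩

/-- Normality speaks of full transcripts, while the attack is analysed round by round; this
transfers the conditions to histories. -/
theorem Reachable.exists_transcript {h : List M} (hr : Pi.Reachable h) (hl : h.length ≤ l) :
    ∃ w ∈ Pi.transcript.support, w.take h.length = h := by
  obtain ⟨w, hw⟩ := (Pi.extend (l - h.length) h).support_nonempty
  refine ⟨w, ?_, ?_⟩
  · have he : Pi.transcript = (Pi.extend h.length []).bind (Pi.extend (l - h.length)) := by
      rw [transcript, ← extend_add, Nat.add_sub_cancel' hl]
    rw [he, PMF.mem_support_bind_iff]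
    exact ⟨h, hr, hw⟩
  · obtain ⟨s, rfl, -⟩ := exists_of_mem_support_extend hw
    simp

theorem IsNormal.neg_lt_jump {n : ℕ} {NR : Fin t} (hn : Pi.IsNormal n NR) {h : List M}
    (hr : Pi.Reachable h) (hl : h.length < l) (hp : Pi.party h ≠ NR) {m : M}
    (hm : m ∈ (Pi.msg h).support) : -(1 / (lam n * Real.sqrt n)) < Pi.jump h m := by
  obtain ⟨w, hw, hwh⟩ := hr.exists_transcript hl.le
  by_contra! hc
  have := (hn.single_nonRobust w hw h.length hl).1
    ⟨Pi.jump h m, by rw [hwh]; exact Set.mem_image_of_mem _ hm, hc⟩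
  rw [idx, Finset.mem_filter, hwh] at this
  exact hp this.2

/-- A party with a large jump reaches the variance threshold in a single round, so only the
unfulfilled small-jumps parties are exceptional. -/
theorem IsNormal.exists_unfulfilled {n : ℕ} {NR : Fin t} (hn : Pi.IsNormal n NR) {w : List M}
    (hw : w ∈ Pi.transcript.support) :
    ∃ U : Finset (Fin t), U.card ≤ n ∧
      ∀ P ≠ NR, (Pi.idx P w).Nonempty → P ∉ U → 1 / (lam n * n) ≤ Pi.totalVar P w := by
  classical
  refine ⟨Finset.univ.filter fun P => Pi.Unfulfilled n NR P w, ?_, fun P hP hne hU => ?_⟩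
  · rw [← Set.ncard_coe_finset]
    simpa using hn.unfulfilled_le w hw
  · by_contra! hlt
    refine hU (Finset.mem_filter.2 ⟨Finset.mem_univ _, ⟨hP, hne, ?_⟩, hlt⟩)
    rintro ⟨-, i, hi, hle⟩
    exact (hle.trans (Finset.single_le_sum
      (fun j _ => Pi.jumpVar_nonneg (w.take j)) hi)).not_gt hlt

end Protocol

/-! ### The attack and the conditional corruption probabilities -/

namespace Protocol

variable {M : Type*} {t l : ℕ}

section Attack

variable (Pi : Protocol M t l) (NR : Fin t) (f κ : ℝ)

open Classical in
/-- The law of a message of the special party that does not decrease the expected outcome. -/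
noncomputable def liftLaw (h : List M) : PMF M :=
  if hm : ∃ m ∈ (Pi.msg h).support, 0 ≤ Pi.jump h m then PMF.pure hm.choose else Pi.msg h

/-- The probability that the next speaker is corrupted when it speaks, as a function of the
probabilities `π` that the parties are corrupted so far. -/
noncomputable def raise (h : List M) (π : Fin t → ℝ) : ℝ :=
  if Pi.party h = NR then 1 else max f (π (Pi.party h))

/-- The law of the next message if its speaker is corrupted, and is so with probability `ρ` given
the public history. -/
noncomputable def biased (h : List M) (ρ : ℝ) : PMF M :=
  if Pi.party h = NR then Pi.liftLaw h
  else reweight (Pi.msg h) fun m => 1 + κ / ρ * Pi.jump h m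

/-- The conditional probabilities that the parties are corrupted, given the public history in
reversed order. -/
noncomputable def postRev : List M → Fin t → ℝ
  | [] => fun _ => 0
  | m :: r => Function.update (postRev r) (Pi.party r.reverse)
      (Pi.raise NR f r.reverse (postRev r) *
          (Pi.biased NR κ r.reverse (Pi.raise NR f r.reverse (postRev r)) m).toReal /
        ((1 - Pi.raise NR f r.reverse (postRev r)) * (Pi.msg r.reverse m).toReal +
          Pi.raise NR f r.reverse (postRev r) *
            (Pi.biased NR κ r.reverse (Pi.raise NR f r.reverse (postRev r)) m).toReal))

/-- The conditional probabilities that the parties are corrupted, given the public history. -/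
noncomputable def post (h : List M) : Fin t → ℝ := Pi.postRev NR f κ h.reverse

/-- The probability that the next speaker is corrupted when it speaks, given the history. -/
noncomputable def raised (h : List M) : ℝ := Pi.raise NR f h (Pi.post NR f κ h)

/-- The law of the next message if its speaker is corrupted. -/
noncomputable def law (h : List M) : PMF M := Pi.biased NR κ h (Pi.raised NR f κ h)

/-- The probability with which the next speaker is added to the list of corrupted parties, if it
is not yet on the list. -/
noncomputable def recruit (h : List M) : ℝ :=
  (Pi.raised NR f κ h - Pi.post NR f κ h (Pi.party h)) / (1 - Pi.post NR f κ h (Pi.party h))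

variable {Pi NR f κ}

theorem post_nil : Pi.post NR f κ [] = fun _ => 0 := rfl

/-- Bayes' rule with prior `raised` and likelihoods `law` (corrupted) and `Pi.msg` (honest). Only
the speaker's probability changes. -/
theorem post_append (h : List M) (m : M) :
    Pi.post NR f κ (h ++ [m]) = Function.update (Pi.post NR f κ h) (Pi.party h)
      (Pi.raised NR f κ h * (Pi.law NR f κ h m).toReal /
        ((1 - Pi.raised NR f κ h) * (Pi.msg h m).toReal +
          Pi.raised NR f κ h * (Pi.law NR f κ h m).toReal)) := by
  rw [law, raised, post, List.reverse_append, List.reverse_singleton, List.singleton_append,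
    postRev, post, List.reverse_reverse]

theorem raise_mem_Icc (hf : 0 < f ∧ f ≤ 1) {h : List M} {π : Fin t → ℝ}
    (hπ : ∀ P, 0 ≤ π P ∧ π P ≤ 1) :
    0 ≤ Pi.raise NR f h π ∧ Pi.raise NR f h π ≤ 1 ∧
      π (Pi.party h) ≤ Pi.raise NR f h π := by
  unfold raise
  split_ifs
  · exact ⟨zero_le_one, le_rfl, (hπ _).2⟩
  · exact ⟨hf.1.le.trans (le_max_left _ _), max_le hf.2 (hπ _).2, le_max_right _ _⟩

theorem post_mem_Icc (hf : 0 < f ∧ f ≤ 1) (h : List M) (P : Fin t) :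
    0 ≤ Pi.post NR f κ h P ∧ Pi.post NR f κ h P ≤ 1 := by
  induction h using List.reverseRecOn generalizing P with
  | nil => simp [post_nil]
  | append_singleton h m ih =>
    rw [post_append]
    obtain ⟨h0, h1, -⟩ := raise_mem_Icc (Pi := Pi) (NR := NR) hf (h := h) ih
    change 0 ≤ Pi.raised NR f κ h at h0
    change Pi.raised NR f κ h ≤ 1 at h1
    have ha : 0 ≤ (1 - Pi.raised NR f κ h) * (Pi.msg h m).toReal :=
      mul_nonneg (sub_nonneg.2 h1) ENNReal.toReal_nonneg
    have hb : 0 ≤ Pi.raised NR f κ h * (Pi.law NR f κ h m).toReal :=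
      mul_nonneg h0 ENNReal.toReal_nonneg
    by_cases hP : P = Pi.party h
    · subst hP
      rw [Function.update_self]
      exact ⟨div_nonneg hb (add_nonneg ha hb),
        div_le_one_of_le₀ (le_add_of_nonneg_left ha) (add_nonneg ha hb)⟩
    · rw [Function.update_of_ne hP]
      exact ih P

theorem raised_mem_Icc (hf : 0 < f ∧ f ≤ 1) (h : List M) :
    0 ≤ Pi.raised NR f κ h ∧ Pi.raised NR f κ h ≤ 1 ∧
      Pi.post NR f κ h (Pi.party h) ≤ Pi.raised NR f κ h :=
  raise_mem_Icc hf (post_mem_Icc hf h)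

/-- Recruiting with probability `r` turns `π` into `π + (1 - π) * r`, which has to equal `raised`.
If `π = 1`, division by zero yields `r = 0`, which is consistent since then `raised = 1` as well. -/
theorem recruit_spec (hf : 0 < f ∧ f ≤ 1) (h : List M) :
    0 ≤ Pi.recruit NR f κ h ∧ Pi.recruit NR f κ h ≤ 1 ∧
      (1 - Pi.post NR f κ h (Pi.party h)) * Pi.recruit NR f κ h =
        Pi.raised NR f κ h - Pi.post NR f κ h (Pi.party h) := by
  obtain ⟨-, h1, h2⟩ := raised_mem_Icc (Pi := Pi) (NR := NR) (κ := κ) hf h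
  obtain ⟨-, h4⟩ := post_mem_Icc (Pi := Pi) (NR := NR) (κ := κ) hf h (Pi.party h)
  unfold recruit
  refine ⟨div_nonneg (by linarith) (by linarith), div_le_one_of_le₀ (by linarith) (by linarith), ?_⟩
  by_cases h5 : 1 - Pi.post NR f κ h (Pi.party h) = 0
  · rw [h5, zero_mul]
    linarith
  · rw [mul_div_cancel₀ _ h5]

theorem support_liftLaw_subset (h : List M) : (Pi.liftLaw h).support ⊆ (Pi.msg h).support := by
  unfold liftLaw
  split_ifs with hm
  · rw [PMF.support_pure, Set.singleton_subset_iff]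
    exact hm.choose_spec.1
  · exact subset_rfl

theorem support_law_subset (h : List M) : (Pi.law NR f κ h).support ⊆ (Pi.msg h).support := by
  unfold law biased
  split_ifs
  · exact support_liftLaw_subset h
  · exact support_reweight_subset _ _

variable (Pi NR f κ) in
open Classical in
/-- The attack that corrupts at most `k` parties.  The special party is corrupted when it first
speaks.  Any other speaker is recruited so that, given the public history, it is corrupted with
probability at least `f`; the bias of its messages is adapted to that probability `ρ`, so that the
public law of the next message has density `1 + κ * jump` with respect to the honest one. -/
noncomputable def attack (k : ℕ) : Adversary Pi where
  corrupt v := if (Pi.corrupted v).ncard < k then coin (Pi.recruit NR f κ v.history)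
    else PMF.pure false
  send v := Pi.law NR f κ v.history
  send_valid v := support_law_subset v.history

theorem history_append (v : View M) (e : Bool × M) :
    View.history (v ++ [e]) = v.history ++ [e.2] := by
  simp [View.history]

theorem mem_corrupted_append (Pi : Protocol M t l) (v : View M) (b : Bool) (m : M) (P : Fin t) :
    P ∈ Pi.corrupted (v ++ [(b, m)]) ↔
      P ∈ Pi.corrupted v ∨ (b = true ∧ Pi.party v.history = P) := by
  have hlen : v.history.length = v.length := by simp [View.history]
  constructor
  · rintro ⟨i, hi, hb, hP⟩
    rw [history_append] at hP
    rw [List.length_append, List.length_singleton] at hi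
    rcases Nat.lt_succ_iff_lt_or_eq.1 hi with hlt | rfl
    · left
      refine ⟨i, hlt, ?_, ?_⟩
      · rwa [List.getElem_append_left hlt] at hb
      · rwa [List.take_append_of_le_length (by omega)] at hP
    · right
      refine ⟨by simpa using hb, ?_⟩
      rwa [List.take_append_of_le_length hlen.ge, ← hlen, List.take_length] at hP
  · rintro (⟨i, hi, hb, hP⟩ | ⟨hb, hP⟩)
    · refine ⟨i, by simp; omega, ?_, ?_⟩
      · rwa [List.getElem_append_left hi]
      · rwa [history_append, List.take_append_of_le_length (by omega)]
    · refine ⟨v.length, by simp, by simpa using hb, ?_⟩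
      rwa [history_append, List.take_append_of_le_length hlen.ge, ← hlen, List.take_length]

theorem corrupted_append_false (Pi : Protocol M t l) (v : View M) (m : M) :
    Pi.corrupted (v ++ [(false, m)]) = Pi.corrupted v := by
  ext P
  simp [mem_corrupted_append]

theorem corrupted_append_true (Pi : Protocol M t l) (v : View M) (m : M) :
    Pi.corrupted (v ++ [(true, m)]) = insert (Pi.party v.history) (Pi.corrupted v) := by
  ext P
  rw [mem_corrupted_append, Set.mem_insert_iff]
  tauto

theorem corrupted_nil (Pi : Protocol M t l) : Pi.corrupted ([] : View M) = ∅ := by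
  ext P
  simp [corrupted]

theorem isAdaptive_attack (k : ℕ) : (Pi.attack NR f κ k).IsAdaptive k := by
  classical
  suffices H : ∀ (j : ℕ) (v : View M), (Pi.corrupted v).ncard ≤ k →
      ∀ w ∈ ((Pi.attack NR f κ k).run j v).support, (Pi.corrupted w).ncard ≤ k from
    H l [] (by simp [corrupted_nil])
  intro j
  induction j with
  | zero =>
    intro v hv w hw
    rw [Adversary.run, PMF.mem_support_pure_iff] at hw
    rwa [hw]
  | succ j ih =>
    intro v hv w hw
    rw [Adversary.run, PMF.mem_support_bind_iff] at hw
    obtain ⟨⟨b, m⟩, he, hw⟩ := hw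
    refine ih _ ?_ w hw
    cases b with
    | false => rwa [corrupted_append_false]
    | true =>
      rw [corrupted_append_true]
      by_cases hP : Pi.party v.history ∈ Pi.corrupted v
      · rwa [Set.insert_eq_of_mem hP]
      · refine (Set.ncard_insert_le _ _).trans ?_
        by_contra hlt
        have hk : ¬(Pi.corrupted v).ncard < k := by omega
        rw [Adversary.step, if_neg hP, attack] at he
        simp [hk] at he

end Attack

end Protocol

/-! ### Cost of the attack without a budget -/

namespace Protocol

variable {M : Type*} {t l : ℕ}

section Loss

variable (Pi : Protocol M t l) (NR : Fin t) (f κ : ℝ)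

/-- The expected cost at the end of the attack without a bound on the number of corruptions, when
`j` rounds are left, from the history `h` and the set `S` of corrupted parties on.  The cost is the
indicator of outcome `0`, plus the fraction of the budget `k` that is used up. -/
noncomputable def loss (k : ℕ) : ℕ → List M → Finset (Fin t) → ℝ
  | 0, h, S => (if Pi.outcome h = true then 0 else 1) + (S.card : ℝ) / k
  | j + 1, h, S =>
    if Pi.party h ∈ S then ex (Pi.law NR f κ h) fun m => loss k j (h ++ [m]) S
    else (1 - Pi.recruit NR f κ h) * (ex (Pi.msg h) fun m => loss k j (h ++ [m]) S) +
      Pi.recruit NR f κ h *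
        ex (Pi.law NR f κ h) fun m => loss k j (h ++ [m]) (insert (Pi.party h) S)

variable {Pi NR f κ}

theorem loss_mem_Icc (hf : 0 < f ∧ f ≤ 1) (k j : ℕ) (h : List M) (S : Finset (Fin t)) :
    (S.card : ℝ) / k ≤ Pi.loss NR f κ k j h S ∧ Pi.loss NR f κ k j h S ≤ 1 + (t : ℝ) / k := by
  induction j generalizing h S with
  | zero =>
    have h1 : (S.card : ℝ) / k ≤ (t : ℝ) / k := by
      gcongr
      simpa using S.card_le_univ
    unfold loss
    split_ifs <;> constructor <;> linarith
  | succ j ih =>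
    have h0 : ∀ S : Finset (Fin t), (0 : ℝ) ≤ (S.card : ℝ) / k := fun S => by positivity
    have hb : ∀ (p : PMF M) (S : Finset (Fin t)),
        Bdd p fun m => Pi.loss NR f κ k j (h ++ [m]) S := fun p S =>
      Bdd.of_mem_Icc (C := 1 + (t : ℝ) / k) fun m => ⟨(h0 S).trans (ih _ _).1, (ih _ _).2⟩
    have hlo : ∀ (p : PMF M) (S : Finset (Fin t)),
        (S.card : ℝ) / k ≤ ex p fun m => Pi.loss NR f κ k j (h ++ [m]) S := fun p S =>
      le_ex_of_le (hb p S) fun m _ => (ih _ _).1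
    have hhi : ∀ (p : PMF M) (S : Finset (Fin t)),
        (ex p fun m => Pi.loss NR f κ k j (h ++ [m]) S) ≤ 1 + (t : ℝ) / k := fun p S =>
      ex_le_of_le (hb p S) fun m _ => (ih _ _).2
    have hins : (S.card : ℝ) / k ≤ ((insert (Pi.party h) S).card : ℝ) / k := by
      gcongr
      exact Finset.subset_insert _ _
    obtain ⟨hr0, hr1, -⟩ := recruit_spec (Pi := Pi) (NR := NR) (κ := κ) hf h
    unfold loss
    split_ifs
    · exact ⟨hlo _ _, hhi _ _⟩
    · have a1 := hlo (Pi.msg h) S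
      have a2 := hins.trans (hlo (Pi.law NR f κ h) (insert (Pi.party h) S))
      have a3 := hhi (Pi.msg h) S
      have a4 := hhi (Pi.law NR f κ h) (insert (Pi.party h) S)
      have hr2 := sub_nonneg.2 hr1
      constructor
      · nlinarith [mul_le_mul_of_nonneg_left a1 hr2, mul_le_mul_of_nonneg_left a2 hr0]
      · nlinarith [mul_le_mul_of_nonneg_left a3 hr2, mul_le_mul_of_nonneg_left a4 hr0]

theorem bdd_loss (hf : 0 < f ∧ f ≤ 1) (k j : ℕ) (h : List M) (S : Finset (Fin t)) (p : PMF M) :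
    Bdd p fun m => Pi.loss NR f κ k j (h ++ [m]) S :=
  Bdd.of_mem_Icc (C := 1 + (t : ℝ) / k) fun m =>
    ⟨le_trans (by positivity) (loss_mem_Icc hf k j (h ++ [m]) S).1,
      (loss_mem_Icc hf k j (h ++ [m]) S).2⟩

/-- The charge `S.card / k` replaces Markov's inequality: once the budget is exhausted the cost is
at least `1` and the bound is trivial, and before that the attacks with and without a budget take
the same step. -/
theorem ex_run_attack_le (hf : 0 < f ∧ f ≤ 1) {k : ℕ} (hk : 0 < k) (j : ℕ) (v : View M)
    (S : Finset (Fin t)) (hS : Pi.corrupted v = S) :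
    (ex ((Pi.attack NR f κ k).run j v) fun w =>
        if Pi.outcome w.history = true then (0 : ℝ) else 1) ≤
      Pi.loss NR f κ k j v.history S := by
  classical
  have hI : ∀ w : View M, 0 ≤ (if Pi.outcome w.history = true then (0 : ℝ) else 1) ∧
      (if Pi.outcome w.history = true then (0 : ℝ) else 1) ≤ 1 := fun w => by
    split_ifs <;> simp
  induction j generalizing v S with
  | zero =>
    rw [Adversary.run, ex_pure, loss]
    exact le_add_of_nonneg_right (by positivity)
  | succ j ih =>
    rcases le_or_gt k S.card with hkS | hkS
    · refine (ex_mem_Icc hI).2.trans (le_trans ?_ (loss_mem_Icc hf k _ _ _).1)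
      rw [le_div_iff₀ (by positivity), one_mul]
      exact_mod_cast hkS
    set F : View M → ℝ := fun w => ex ((Pi.attack NR f κ k).run j w) fun w =>
        if Pi.outcome w.history = true then (0 : ℝ) else 1 with hF
    have hFI : ∀ w, 0 ≤ F w ∧ F w ≤ 1 := fun w => ex_mem_Icc hI
    have hsend : ∀ b : Bool, (ex ((if b = true then (Pi.attack NR f κ k).send v
        else Pi.msg v.history).map fun m => (b, m)) fun e => F (v ++ [e])) =
        ex (if b = true then Pi.law NR f κ v.history else Pi.msg v.history)
          fun m => F (v ++ [(b, m)]) := fun b => ex_map fun e => hFI _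
    have hfalse : (ex (Pi.msg v.history) fun m => F (v ++ [(false, m)])) ≤
        ex (Pi.msg v.history) fun m => Pi.loss NR f κ k j (v.history ++ [m]) S := by
      refine ex_mono (Bdd.of_mem_Icc fun m => hFI _) (bdd_loss hf _ _ _ _ _) fun m _ => ?_
      have := ih (v ++ [(false, m)]) S (by rw [corrupted_append_false, hS])
      rwa [history_append] at this
    have htrue : (ex (Pi.law NR f κ v.history) fun m => F (v ++ [(true, m)])) ≤
        ex (Pi.law NR f κ v.history) fun m =>
          Pi.loss NR f κ k j (v.history ++ [m]) (insert (Pi.party v.history) S) := by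
      refine ex_mono (Bdd.of_mem_Icc fun m => hFI _) (bdd_loss hf _ _ _ _ _) fun m _ => ?_
      have := ih (v ++ [(true, m)]) (insert (Pi.party v.history) S)
        (by rw [corrupted_append_true, hS, Finset.coe_insert])
      rwa [history_append] at this
    rw [Adversary.run, ex_bind hI, Adversary.step, ex_bind (C := 1) fun e => hFI _]
    simp only [hsend]
    rw [loss, hS]
    simp only [Finset.mem_coe]
    split_ifs with hP
    · rw [ex_pure, if_pos rfl]
      rwa [Finset.insert_eq_of_mem hP] at htrue
    · obtain ⟨hr0, hr1, -⟩ := recruit_spec (Pi := Pi) (NR := NR) (κ := κ) hf v.history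
      have hc : (Pi.attack NR f κ k).corrupt v = coin (Pi.recruit NR f κ v.history) := by
        rw [attack]
        simp only [hS, Set.ncard_coe_finset, hkS, if_true]
      rw [hc, ex_coin hr0 hr1]
      exact add_le_add (mul_le_mul_of_nonneg_left hfalse (sub_nonneg.2 hr1))
        (mul_le_mul_of_nonneg_left htrue hr0)

end Loss

/-! ### Independent memberships in the corrupted set -/

section Product

/-- The probability that `S` is the set of successes among independent trials with success
probabilities `π`. -/
noncomputable def prodWeight (π : Fin t → ℝ) (S : Finset (Fin t)) : ℝ :=
  ∏ P, if P ∈ S then π P else 1 - π P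

/-- The factor of `prodWeight` that is due to the parties other than `P`. -/
noncomputable def prodWeightErase (P : Fin t) (π : Fin t → ℝ) (S : Finset (Fin t)) : ℝ :=
  ∏ Q ∈ Finset.univ.erase P, if Q ∈ S then π Q else 1 - π Q

/-- Splits according to whether `P` is a success; a round only affects the coordinate of its
speaker. -/
theorem sum_prodWeight_mul (P : Fin t) (π : Fin t → ℝ) (F : Finset (Fin t) → ℝ) :
    ∑ S, prodWeight π S * F S =
      ∑ S ∈ (Finset.univ.erase P).powerset, prodWeightErase P π S *
        ((1 - π P) * F S + π P * F (insert P S)) := by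
  have hu : (Finset.univ : Finset (Finset (Fin t))) =
      (insert P (Finset.univ.erase P)).powerset := by
    rw [Finset.insert_erase (Finset.mem_univ P), Finset.powerset_univ]
  rw [hu, Finset.sum_powerset_insert (Finset.notMem_erase _ _), ← Finset.sum_add_distrib]
  refine Finset.sum_congr rfl fun S hS => ?_
  have hP : P ∉ S := fun h => Finset.notMem_erase _ _ (Finset.mem_powerset.1 hS h)
  have h1 : prodWeight π S = (1 - π P) * prodWeightErase P π S := by
    rw [prodWeight, ← Finset.mul_prod_erase _ _ (Finset.mem_univ P), if_neg hP, prodWeightErase]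
  have h2 : prodWeight π (insert P S) = π P * prodWeightErase P π S := by
    rw [prodWeight, ← Finset.mul_prod_erase _ _ (Finset.mem_univ P),
      if_pos (Finset.mem_insert_self _ _), prodWeightErase]
    congr 1
    refine Finset.prod_congr rfl fun Q hQ => ?_
    simp only [Finset.mem_insert, Finset.ne_of_mem_erase hQ, false_or]
  rw [h1, h2]
  ring

theorem prodWeightErase_update (P : Fin t) (π : Fin t → ℝ) (x : ℝ) (S : Finset (Fin t)) :
    prodWeightErase P (Function.update π P x) S = prodWeightErase P π S :=
  Finset.prod_congr rfl fun Q hQ => by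
    rw [Function.update_of_ne (Finset.ne_of_mem_erase hQ)]

theorem sum_prodWeight (π : Fin t → ℝ) : ∑ S, prodWeight π S = 1 := by
  have h := Finset.prod_add π (fun P => 1 - π P) Finset.univ
  simp only [add_sub_cancel, Finset.prod_const_one, Finset.powerset_univ] at h
  rw [h]
  refine Finset.sum_congr rfl fun S _ => ?_
  rw [prodWeight, Finset.prod_ite]
  congr 2 <;> ext P <;> simp

theorem sum_prodWeight_mul_card (π : Fin t → ℝ) :
    ∑ S, prodWeight π S * (S.card : ℝ) = ∑ P, π P := by
  have h1 : ∀ S : Finset (Fin t), (S.card : ℝ) = ∑ P, if P ∈ S then 1 else 0 := fun S => by simp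
  simp only [h1, Finset.mul_sum]
  rw [Finset.sum_comm]
  refine Finset.sum_congr rfl fun P _ => ?_
  have h2 := sum_prodWeight_mul P π fun _ => 1
  simp only [mul_one, sub_add_cancel, sum_prodWeight] at h2
  rw [sum_prodWeight_mul P]
  conv_rhs => rw [← mul_one (π P), h2, Finset.mul_sum]
  refine Finset.sum_congr rfl fun S hS => ?_
  have hP : P ∉ S := fun h => Finset.notMem_erase _ _ (Finset.mem_powerset.1 hS h)
  simp [hP, mul_comm]

end Product

/-! ### Averaging the cost over the corrupted set given the public history -/

section Average

variable {Pi : Protocol M t l} {NR : Fin t} {f κ : ℝ}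

/-- The expected cost of the attack is bounded by every potential that bounds the final cost, given
the public history, and does not increase in expectation. -/
theorem sum_loss_le (hf : 0 < f ∧ f ≤ 1) (k : ℕ) (Φ : List M → ℝ)
    (hend : ∀ h, Pi.Reachable h → h.length = l →
      (if Pi.outcome h = true then 0 else 1) + (∑ P, Pi.post NR f κ h P) / k ≤ Φ h)
    (hbdd : ∀ h, Pi.Reachable h → h.length < l → Bdd (Pi.msg h) fun m => Φ (h ++ [m]))
    (hstep : ∀ h, Pi.Reachable h → h.length < l →
      (1 - Pi.raised NR f κ h) * (ex (Pi.msg h) fun m => Φ (h ++ [m])) +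
        Pi.raised NR f κ h * (ex (Pi.law NR f κ h) fun m => Φ (h ++ [m])) ≤ Φ h)
    (j : ℕ) (h : List M) (hr : Pi.Reachable h) (hl : h.length + j = l) :
    ∑ S, prodWeight (Pi.post NR f κ h) S * Pi.loss NR f κ k j h S ≤ Φ h := by
  induction j generalizing h with
  | zero =>
    refine le_trans (le_of_eq ?_) (hend h hr hl)
    simp only [loss, mul_add, Finset.sum_add_distrib, ← Finset.sum_mul, sum_prodWeight, one_mul,
      mul_div_assoc']
    rw [← Finset.sum_div, sum_prodWeight_mul_card]
  | succ j ih =>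
    refine le_trans ?_ (hstep h hr (by omega))
    set P := Pi.party h with hPd
    set π := Pi.post NR f κ h with hπ
    set ρ := Pi.raised NR f κ h with hρ
    set E := (Finset.univ.erase P).powerset
    have hsub := support_law_subset (Pi := Pi) (NR := NR) (f := f) (κ := κ) h
    obtain ⟨-, -, hrec⟩ := recruit_spec (Pi := Pi) (NR := NR) (κ := κ) hf h
    obtain ⟨hρ0, hρ1, -⟩ := raised_mem_Icc (Pi := Pi) (NR := NR) (κ := κ) hf h
    have hB := fun S p => bdd_loss (Pi := Pi) (NR := NR) (κ := κ) hf k j h S p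
    -- Before the message is sent, recruitment changes the speaker's probability from `π P` to `ρ`;
    -- the other coordinates keep their product weight.
    have hL : ∑ S, prodWeight π S * Pi.loss NR f κ k (j + 1) h S =
        (1 - ρ) * (ex (Pi.msg h) fun m => ∑ S ∈ E,
          prodWeightErase P π S * Pi.loss NR f κ k j (h ++ [m]) S) +
        ρ * (ex (Pi.law NR f κ h) fun m => ∑ S ∈ E,
          prodWeightErase P π S * Pi.loss NR f κ k j (h ++ [m]) (insert P S)) := by
      rw [ex_sum _ fun S => (Bdd.const _ _).mul (hB S _),
        ex_sum _ fun S => (Bdd.const _ _).mul (hB (insert P S) _)]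
      simp only [ex_const_mul]
      rw [Finset.mul_sum, Finset.mul_sum, ← Finset.sum_add_distrib, sum_prodWeight_mul P]
      refine Finset.sum_congr rfl fun S hS => ?_
      have hP : P ∉ S := fun h => Finset.notMem_erase _ _ (Finset.mem_powerset.1 hS h)
      rw [loss, loss, if_neg hP, if_pos (Finset.mem_insert_self _ _)]
      linear_combination prodWeightErase P π S *
        ((ex (Pi.law NR f κ h) fun m => Pi.loss NR f κ k j (h ++ [m]) (insert P S)) -
          ex (Pi.msg h) fun m => Pi.loss NR f κ k j (h ++ [m]) S) * hrec
    rw [hL]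
    have hbl := hbdd h hr (by omega)
    have hBs : ∀ (p : PMF M) (G : Finset (Fin t) → Finset (Fin t)), Bdd p fun m => ∑ S ∈ E,
        prodWeightErase P π S * Pi.loss NR f κ k j (h ++ [m]) (G S) := fun p G =>
      Bdd.sum E fun S => (Bdd.const _ _).mul (hB _ _)
    -- It suffices to compare message by message: the public weight `q` of `m` times the updated
    -- product law splits into an honest and a corrupted part, so independence is preserved.
    refine mix_le (hBs _ id) (hBs _ _) hbl
      (hbl.imp fun C hC m hm => hC m (hsub hm)) fun m => ?_
    have hm0 : 0 ≤ (1 - ρ) * (Pi.msg h m).toReal :=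
      mul_nonneg (sub_nonneg.2 hρ1) ENNReal.toReal_nonneg
    have hm1 : 0 ≤ ρ * (Pi.law NR f κ h m).toReal := mul_nonneg hρ0 ENNReal.toReal_nonneg
    by_cases hm : m ∈ (Pi.msg h).support
    · have := ih (h ++ [m]) (hr.append hm)
        (by rw [List.length_append, List.length_singleton]; omega)
      rw [sum_prodWeight_mul P, post_append, ← hPd] at this
      simp only [prodWeightErase_update, Function.update_self] at this
      change ∑ S ∈ E, _ ≤ _ at this
      rw [← hρ, ← hπ] at this
      set q := (1 - ρ) * (Pi.msg h m).toReal + ρ * (Pi.law NR f κ h m).toReal with hq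
      -- If `m` has public weight zero, the posterior is a meaningless `0 / 0`, but both sides
      -- vanish.
      rcases (add_nonneg hm0 hm1).eq_or_lt with h0 | h0
      · have e0 : (1 - ρ) * (Pi.msg h m).toReal = 0 := by linarith
        have e1 : ρ * (Pi.law NR f κ h m).toReal = 0 := by linarith
        rw [e0, e1, hq, e0, e1]
        simp
      · refine le_trans (le_of_eq ?_) (mul_le_mul_of_nonneg_left this h0.le)
        rw [← hq] at h0
        simp only [Finset.mul_sum]
        rw [← Finset.sum_add_distrib]
        refine Finset.sum_congr rfl fun S _ => ?_
        have hx : q * (1 - ρ * (Pi.law NR f κ h m).toReal / q) =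
            (1 - ρ) * (Pi.msg h m).toReal := by
          field_simp
          rw [hq]
          ring
        have hy : q * (ρ * (Pi.law NR f κ h m).toReal / q) =
            ρ * (Pi.law NR f κ h m).toReal := mul_div_cancel₀ _ h0.ne'
        linear_combination -(prodWeightErase P π S * Pi.loss NR f κ k j (h ++ [m]) S) * hx -
          prodWeightErase P π S * Pi.loss NR f κ k j (h ++ [m]) (insert P S) * hy
    · rw [toReal_eq_zero hm, toReal_eq_zero fun hc => hm (hsub hc)]
      simp

end Average

end Protocol

/-! ### The potential -/

namespace Protocol

variable {M : Type*} {t l : ℕ} {Pi : Protocol M t l} {NR : Fin t} {f κ : ℝ}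

variable (Pi NR) in
/-- The sum of the conditional variances of the jumps of the parties other than the special one. -/
noncomputable def varSum (h : List M) : ℝ :=
  ∑ i ∈ Finset.range h.length,
    if Pi.party (h.take i) = NR then 0 else Pi.jumpVar (h.take i)

theorem varSum_append (h : List M) (m : M) :
    Pi.varSum NR (h ++ [m]) =
      Pi.varSum NR h + if Pi.party h = NR then 0 else Pi.jumpVar h := by
  rw [varSum, List.length_append, List.length_singleton, Finset.sum_range_succ,
    List.take_append_of_le_length le_rfl, List.take_length, varSum]
  congr 1
  refine Finset.sum_congr rfl fun i hi => ?_
  rw [List.take_append_of_le_length (Finset.mem_range.1 hi).le]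

/-- Every round has one speaker, so it is counted at most once on the left. -/
theorem sum_totalVar_le_varSum {h : List M} (hl : h.length = l) {T : Finset (Fin t)}
    (hT : NR ∉ T) : ∑ P ∈ T, Pi.totalVar P h ≤ Pi.varSum NR h := by
  simp only [totalVar, idx, Finset.sum_filter]
  rw [Finset.sum_comm, varSum, hl]
  refine Finset.sum_le_sum fun i _ => ?_
  rw [Finset.sum_ite_eq]
  have h0 := Pi.jumpVar_nonneg (h.take i)
  split_ifs with h1 h2
  · exact absurd (h2 ▸ h1) hT
  · exact le_rfl
  · exact le_rfl
  · exact h0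

theorem post_eq_zero {h : List M} {P : Fin t} (hP : ∀ i < h.length, Pi.party (h.take i) ≠ P) :
    Pi.post NR f κ h P = 0 := by
  induction h using List.reverseRecOn with
  | nil => rfl
  | append_singleton h m ih =>
    have h1 := hP h.length (by simp)
    rw [List.take_append_of_le_length le_rfl, List.take_length] at h1
    rw [post_append, Function.update_of_ne h1.symm]
    refine ih fun i hi => ?_
    have h2 := hP i (by simp; omega)
    rwa [List.take_append_of_le_length hi.le] at h2

/-- If all but few parties of a full transcript have a large total variance, then few parties
participate compared to the overall variance. -/
theorem card_participants_le {h : List M} (hl : h.length = l) {U : Finset (Fin t)} {β : ℝ}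
    (hβ : 0 < β)
    (hU : ∀ P ≠ NR, (Pi.idx P h).Nonempty → P ∉ U → β ≤ Pi.totalVar P h) :
    (((Finset.univ.erase NR).filter fun P => (Pi.idx P h).Nonempty).card : ℝ) ≤
      U.card + Pi.varSum NR h / β := by
  set T := (Finset.univ.erase NR).filter fun P => (Pi.idx P h).Nonempty with hT
  have h1 : (T.card : ℝ) ≤ U.card + (T \ U).card := by
    have := Finset.card_le_card (Finset.subset_union_left (s₁ := T) (s₂ := U))
    rw [Finset.union_comm, ← Finset.union_sdiff_self_eq_union] at this
    exact_mod_cast this.trans (Finset.card_union_le _ _)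
  have hmem : ∀ P ∈ T \ U, P ≠ NR ∧ (Pi.idx P h).Nonempty ∧ P ∉ U := fun P hP => by
    rw [Finset.mem_sdiff, hT, Finset.mem_filter, Finset.mem_erase] at hP
    exact ⟨hP.1.1.1, hP.1.2, hP.2⟩
  have h2 : (T \ U).card * β ≤ Pi.varSum NR h := by
    rw [← nsmul_eq_mul]
    refine (Finset.card_nsmul_le_sum _ _ _ fun P hP => ?_).trans
      (sum_totalVar_le_varSum hl (T := T \ U) fun hc => (hmem _ hc).1 rfl)
    obtain ⟨a, b, c⟩ := hmem P hP
    exact hU P a b c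
  have h3 := (le_div_iff₀ hβ).2 h2
  linarith

variable (Pi NR f κ) in
/-- The potential that bounds the cost of the attack. -/
noncomputable def potential (d c e k : ℝ) (h : List M) : ℝ :=
  Real.exp (-κ * Pi.value h) +
    ((∑ P ∈ Finset.univ.erase NR, (Pi.post NR f κ h P ^ 2 / (2 * f) - Pi.post NR f κ h P)) +
      d * Pi.varSum NR h - c * Pi.value h + e) / k

theorem bdd_potential (hf : 0 < f ∧ f ≤ 1) (hκ : 0 < κ) (d c e k : ℝ) (h : List M) (p : PMF M) :
    Bdd p fun m => Pi.potential NR f κ d c e k (h ++ [m]) := by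
  have hv : Bdd p fun m => Pi.value (h ++ [m]) :=
    Bdd.of_mem_Icc (C := 1) fun m => Pi.value_mem_Icc _
  have hexp : Bdd p fun m => Real.exp (-κ * Pi.value (h ++ [m])) :=
    Bdd.of_mem_Icc (C := 1) fun m => ⟨(Real.exp_pos _).le, Real.exp_le_one_iff.2 (by
      nlinarith [mul_nonneg hκ.le (Pi.value_mem_Icc (h ++ [m])).1])⟩
  have hp : ∀ P, Bdd p fun m => Pi.post NR f κ (h ++ [m]) P := fun P =>
    Bdd.of_mem_Icc (C := 1) fun m => post_mem_Icc hf _ P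
  have hq : Bdd p fun m => ∑ P ∈ Finset.univ.erase NR,
      (Pi.post NR f κ (h ++ [m]) P * Pi.post NR f κ (h ++ [m]) P * (1 / (2 * f)) +
        (-1) * Pi.post NR f κ (h ++ [m]) P) := by
    refine Bdd.sum _ fun P => ?_
    exact (((hp P).mul (hp P)).mul (Bdd.const p _)).add ((Bdd.const p (-1)).mul (hp P))
  have hall := hexp.add ((hq.add ((Bdd.const p (d * (Pi.varSum NR h +
    if Pi.party h = NR then 0 else Pi.jumpVar h) + e)).add ((Bdd.const p (-c)).mul hv))).mul
      (Bdd.const p (1 / k)))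
  refine hall.mono fun m _ => le_of_eq ?_
  congr 1
  rw [potential, varSum_append]
  congr 1
  rw [div_eq_mul_one_div]
  congr 1
  have : ∀ x : ℝ, x ^ 2 / (2 * f) - x = x * x * (1 / (2 * f)) + (-1) * x := fun x => by ring
  simp only [this]
  ring

/-- The special party is surely corrupted here and sends a fixed message that does not lower the
value; its variance and its probability do not enter the potential. -/
theorem potential_le_of_special (hκ : 0 < κ) {d c e k : ℝ} (hc : 0 ≤ c)
    (hk : 0 < k) {h : List M} (hl : h.length < l) (hp : Pi.party h = NR) :
    (1 - Pi.raised NR f κ h) *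
        (ex (Pi.msg h) fun m => Pi.potential NR f κ d c e k (h ++ [m])) +
      Pi.raised NR f κ h *
        (ex (Pi.law NR f κ h) fun m => Pi.potential NR f κ d c e k (h ++ [m])) ≤
      Pi.potential NR f κ d c e k h := by
  have hr : Pi.raised NR f κ h = 1 := by rw [raised, raise, if_pos hp]
  have hm := exists_nonneg_of_ex_eq_zero (Pi.bdd_jump h) (ex_jump hl)
  rw [hr, law, biased, if_pos hp, liftLaw, dif_pos hm, ex_pure, sub_self, zero_mul, zero_add,
    one_mul]
  have hj := hm.choose_spec.2
  set m := hm.choose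
  have hv : Pi.value h ≤ Pi.value (h ++ [m]) := sub_nonneg.1 hj
  rw [potential, potential, varSum_append, if_pos hp, add_zero]
  refine add_le_add (Real.exp_le_exp.2 (by nlinarith)) ?_
  gcongr ?_ / k
  have hs : ∑ P ∈ Finset.univ.erase NR,
      (Pi.post NR f κ (h ++ [m]) P ^ 2 / (2 * f) - Pi.post NR f κ (h ++ [m]) P) =
      ∑ P ∈ Finset.univ.erase NR, (Pi.post NR f κ h P ^ 2 / (2 * f) - Pi.post NR f κ h P) :=
    Finset.sum_congr rfl fun P hP => by
      rw [post_append, hp, Function.update_of_ne (Finset.ne_of_mem_erase hP)]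
  rw [hs]
  nlinarith [mul_le_mul_of_nonneg_left hv hc]

/-- With `x = κ * jump`, the posterior is `(ρ + x) / (1 + x)` and the public density is `1 + x`. The
term linear in `x` has mean zero, so a round costs only the quadratic term. -/
theorem weighted_update_le {ρ x p : ℝ} (hf : 0 < f) (hρ : ρ = max f p) (hρ1 : ρ ≤ 1)
    (hx : -(1 / 2) ≤ x) :
    (1 + x) * (((ρ + x) / (1 + x)) ^ 2 / (2 * f) - (ρ + x) / (1 + x)) ≤
      p ^ 2 / (2 * f) - p + ((2 * ρ - ρ ^ 2) / (2 * f) - 1) * x + x ^ 2 / f := by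
  have h1 : 0 < 1 + x := by linarith
  have hρ0 : 0 < ρ := hρ ▸ lt_max_of_lt_left hf
  have e1 : (1 + x) * (((ρ + x) / (1 + x)) ^ 2 / (2 * f) - (ρ + x) / (1 + x)) =
      (ρ ^ 2 + (2 * ρ - ρ ^ 2) * x + (1 - ρ) ^ 2 * x ^ 2 / (1 + x)) / (2 * f) - (ρ + x) := by
    field_simp
    ring
  have e2 : (1 - ρ) ^ 2 * x ^ 2 / (1 + x) ≤ 2 * x ^ 2 := by
    rw [div_le_iff₀ h1]
    have : (1 - ρ) ^ 2 ≤ 1 := by nlinarith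
    nlinarith [sq_nonneg x, mul_le_mul_of_nonneg_right this (sq_nonneg x)]
  -- Recruitment is free: either `ρ = p`, or `ρ = f` is the minimizer of the quadratic.
  have e3 : ρ ^ 2 / (2 * f) - ρ ≤ p ^ 2 / (2 * f) - p := by
    rcases le_total f p with h | h
    · rw [hρ, max_eq_right h]
    · rw [hρ, max_eq_left h]
      have : p ^ 2 / (2 * f) - p - (f ^ 2 / (2 * f) - f) = (f - p) ^ 2 / (2 * f) := by
        field_simp
        ring
      have : 0 ≤ (f - p) ^ 2 / (2 * f) := by positivity
      linarith
  rw [e1]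
  have e4 : (ρ ^ 2 + (2 * ρ - ρ ^ 2) * x + (1 - ρ) ^ 2 * x ^ 2 / (1 + x)) / (2 * f) ≤
      (ρ ^ 2 + (2 * ρ - ρ ^ 2) * x + 2 * x ^ 2) / (2 * f) := by gcongr
  have e5 : (ρ ^ 2 + (2 * ρ - ρ ^ 2) * x + 2 * x ^ 2) / (2 * f) - (ρ + x) =
      ρ ^ 2 / (2 * f) - ρ + ((2 * ρ - ρ ^ 2) / (2 * f) - 1) * x + x ^ 2 / f := by
    field_simp
    ring
  linarith

/-- In one round the Bayes update costs at most `κ ^ 2 / f * v` and the variance term costs `d * v`,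
while `-c * value` falls in mean by `c * κ * v`; `hc` balances the three. -/
theorem potential_le_of_ordinary (hf : 0 < f ∧ f ≤ 1) (hκ : 0 < κ) {d c e k a : ℝ}
    (hc : c * κ = κ ^ 2 / f + d) (hk : 0 < k) (ha : κ * a ≤ f / 2)
    {h : List M} (hl : h.length < l) (hp : Pi.party h ≠ NR)
    (hj : ∀ m ∈ (Pi.msg h).support, -a < Pi.jump h m) :
    (1 - Pi.raised NR f κ h) *
        (ex (Pi.msg h) fun m => Pi.potential NR f κ d c e k (h ++ [m])) +
      Pi.raised NR f κ h *
        (ex (Pi.law NR f κ h) fun m => Pi.potential NR f κ d c e k (h ++ [m])) ≤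
      Pi.potential NR f κ d c e k h := by
  obtain ⟨-, hρ1, -⟩ := raised_mem_Icc (Pi := Pi) (NR := NR) (κ := κ) hf h
  have hρ : Pi.raised NR f κ h = max f (Pi.post NR f κ h (Pi.party h)) := by
    rw [raised, raise, if_neg hp]
  set ρ := Pi.raised NR f κ h with hρd
  have hρf : f ≤ ρ := hρ ▸ le_max_left _ _
  have hρ0 : 0 < ρ := hf.1.trans_le hρf
  have hx : ∀ m ∈ (Pi.msg h).support, -(f / 2) ≤ κ * Pi.jump h m := fun m hm => by
    nlinarith [hj m hm]
  have hx2 : ∀ m ∈ (Pi.msg h).support, -(1 / 2) ≤ κ * Pi.jump h m := fun m hm => by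
    linarith [hx m hm, hf.2]
  have hg : ∀ m ∈ (Pi.msg h).support, 0 ≤ 1 + κ / ρ * Pi.jump h m := fun m hm => by
    have : 1 + κ / ρ * Pi.jump h m = (ρ + κ * Pi.jump h m) / ρ := by field_simp
    rw [this]
    exact div_nonneg (by linarith [hx m hm]) hρ0.le
  have hgb : Bdd (Pi.msg h) fun m => 1 + κ / ρ * Pi.jump h m :=
    (Bdd.const _ _).add ((Bdd.const _ _).mul (Pi.bdd_jump h))
  have hg1 : (ex (Pi.msg h) fun m => 1 + κ / ρ * Pi.jump h m) = 1 := by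
    rw [ex_add (Bdd.const _ _) ((Bdd.const _ _).mul (Pi.bdd_jump h)), ex_const, ex_const_mul,
      ex_jump hl, mul_zero, add_zero]
  have hlaw : Pi.law NR f κ h = reweight (Pi.msg h) fun m => 1 + κ / ρ * Pi.jump h m := by
    rw [law, biased, if_neg hp]
  have hΦ := bdd_potential (Pi := Pi) (NR := NR) hf hκ d c e k h (Pi.msg h)
  set Φ := Pi.potential NR f κ d c e k with hΦd
  have hmix : (1 - ρ) * (ex (Pi.msg h) fun m => Φ (h ++ [m])) +
      ρ * (ex (Pi.law NR f κ h) fun m => Φ (h ++ [m])) =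
      ex (Pi.msg h) fun m => (1 + κ * Pi.jump h m) * Φ (h ++ [m]) := by
    rw [hlaw, ex_reweight hg hgb hg1, ← ex_const_mul, ← ex_const_mul,
      ← ex_add ((Bdd.const _ _).mul hΦ) ((Bdd.const _ _).mul (hgb.mul hΦ))]
    refine ex_congr fun m _ => ?_
    field_simp
    ring
  rw [hmix]
  have hpost : ∀ m ∈ (Pi.msg h).support, Pi.post NR f κ (h ++ [m]) =
      Function.update (Pi.post NR f κ h) (Pi.party h)
        ((ρ + κ * Pi.jump h m) / (1 + κ * Pi.jump h m)) := fun m hm => by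
    rw [post_append, hlaw, reweight_toReal hg hgb hg1, ← hρd]
    congr 1
    have h1 := toReal_pos hm
    have h2 : 0 < 1 + κ * Pi.jump h m := by linarith [hx2 m hm]
    have h3 : (1 - ρ) * ((Pi.msg h) m).toReal +
        ρ * (((Pi.msg h) m).toReal * (1 + κ / ρ * Pi.jump h m)) =
        ((Pi.msg h) m).toReal * (1 + κ * Pi.jump h m) := by
      field_simp
      ring
    rw [h3, div_eq_div_iff (mul_pos h1 h2).ne' h2.ne']
    field_simp
  set π := Pi.post NR f κ h with hπ
  set P := Pi.party h with hPd
  set G₀ := ∑ Q ∈ (Finset.univ.erase NR).erase P, (π Q ^ 2 / (2 * f) - π Q) with hG₀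
  set V := Pi.varSum NR h with hV
  set v := Pi.jumpVar h with hv
  set Y := Pi.value h with hY
  have hPN : P ∈ Finset.univ.erase NR := Finset.mem_erase.2 ⟨hp, Finset.mem_univ _⟩
  have hΦh : Φ h = Real.exp (-κ * Y) +
      ((π P ^ 2 / (2 * f) - π P + G₀) + d * V - c * Y + e) / k := by
    rw [hΦd, potential, ← Finset.add_sum_erase _ _ hPN]
  -- `A` collects the coefficients of the jump. It does not depend on the message, so its
  -- contribution has mean zero.
  set A := (G₀ + ((2 * ρ - ρ ^ 2) / (2 * f) - 1) + d * (V + v) - c * Y + e) * κ - c with hA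
  have hpt : ∀ m ∈ (Pi.msg h).support, (1 + κ * Pi.jump h m) * Φ (h ++ [m]) ≤
      (Φ h + d * v / k) + (A / k * Pi.jump h m + (κ ^ 2 / f - c * κ) / k * Pi.jump h m ^ 2) := by
    intro m hm
    have hYm : Pi.value (h ++ [m]) = Y + Pi.jump h m := by rw [jump, hY]; ring
    have hΦm : Φ (h ++ [m]) = Real.exp (-κ * (Y + Pi.jump h m)) +
        (((((ρ + κ * Pi.jump h m) / (1 + κ * Pi.jump h m)) ^ 2 / (2 * f) -
          (ρ + κ * Pi.jump h m) / (1 + κ * Pi.jump h m)) + G₀) +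
          d * (V + v) - c * (Y + Pi.jump h m) + e) / k := by
      rw [hΦd, potential, hYm, varSum_append, if_neg hp, ← Finset.add_sum_erase _ _ hPN,
        hpost m hm, Function.update_self]
      congr 6
      refine Finset.sum_congr rfl fun Q hQ => ?_
      rw [Function.update_of_ne (Finset.ne_of_mem_erase hQ)]
    rw [hΦm, hΦh]
    have hup := weighted_update_le hf.1 hρ hρ1 (hx2 m hm)
    set J := Pi.jump h m
    have hexp : (1 + κ * J) * Real.exp (-κ * (Y + J)) ≤ Real.exp (-κ * Y) := by
      have h1 : Real.exp (-κ * Y) = Real.exp (κ * J) * Real.exp (-κ * (Y + J)) := by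
        rw [← Real.exp_add]
        congr 1
        ring
      rw [h1]
      exact mul_le_mul_of_nonneg_right (by linarith [Real.add_one_le_exp (κ * J)])
        (Real.exp_pos _).le
    set Γ := ((ρ + κ * J) / (1 + κ * J)) ^ 2 / (2 * f) - (ρ + κ * J) / (1 + κ * J)
    have hk2 : (1 + κ * J) * ((Γ + G₀ + d * (V + v) - c * (Y + J) + e)) ≤
        (π P ^ 2 / (2 * f) - π P + G₀ + d * V - c * Y + e) + d * v + A * J +
          (κ ^ 2 / f - c * κ) * J ^ 2 := by
      have : (κ * J) ^ 2 / f = κ ^ 2 / f * J ^ 2 := by ring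
      rw [hA]
      nlinarith
    have hk3 := div_le_div_of_nonneg_right hk2 hk.le
    have e1 : (1 + κ * J) * ((Γ + G₀ + d * (V + v) - c * (Y + J) + e)) / k =
        (1 + κ * J) * ((Γ + G₀ + d * (V + v) - c * (Y + J) + e) / k) := by ring
    have e2 : ((π P ^ 2 / (2 * f) - π P + G₀ + d * V - c * Y + e) + d * v + A * J +
          (κ ^ 2 / f - c * κ) * J ^ 2) / k =
        (π P ^ 2 / (2 * f) - π P + G₀ + d * V - c * Y + e) / k + d * v / k +
          (A / k * J + (κ ^ 2 / f - c * κ) / k * J ^ 2) := by ring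
    rw [e1, e2] at hk3
    linarith
  have hJ := Pi.bdd_jump h
  have hJ2 : Bdd (Pi.msg h) fun m => Pi.jump h m ^ 2 := by simpa only [sq] using hJ.mul hJ
  have hb1 := ((Bdd.const (Pi.msg h) (A / k)).mul hJ)
  have hb2 := ((Bdd.const (Pi.msg h) ((κ ^ 2 / f - c * κ) / k)).mul hJ2)
  refine (ex_mono (((Bdd.const _ _).add ((Bdd.const _ _).mul hJ)).mul hΦ)
    ((Bdd.const _ (Φ h + d * v / k)).add (hb1.add hb2)) hpt).trans (le_of_eq ?_)
  rw [ex_add (Bdd.const _ _) (hb1.add hb2), ex_add hb1 hb2, ex_const, ex_const_mul, ex_const_mul,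
    ex_jump hl, ← jumpVar_eq_ex hl, ← hv, hc]
  ring

/-- The summands of `e` pay, in order, for the special party, for the at most `n` exceptional
parties, and for the term `-c * value`; the remaining participants are paid for by `d * varSum`. -/
theorem cost_le_potential (hf : 0 < f ∧ f ≤ 1) {n : ℕ} {β d c e k : ℝ} (hβ : 0 < β)
    (hk : 0 < k) (hc : 0 ≤ c) (hd : d = 2 * f / β) (he : e = 1 + 2 * f * n + c)
    {h : List M} (hl : h.length = l) {U : Finset (Fin t)} (hUn : U.card ≤ n)
    (hU : ∀ P ≠ NR, (Pi.idx P h).Nonempty → P ∉ U → β ≤ Pi.totalVar P h) :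
    (if Pi.outcome h = true then 0 else 1) + (∑ P, Pi.post NR f κ h P) / k ≤
      Pi.potential NR f κ d c e k h := by
  have hcard := card_participants_le hl hβ hU
  rw [potential]
  refine add_le_add ?_ ?_
  · rw [value_of_length_eq hl]
    split_ifs
    · exact (Real.exp_pos _).le
    · simp
  · gcongr ?_ / k
    -- For a participant the difference of the two sides is the square `(π - 2 * f) ^ 2 / (2 * f)`;
    -- a party that never spoke has `π = 0`.
    have hpt : ∀ P, Pi.post NR f κ h P ≤
        (Pi.post NR f κ h P ^ 2 / (2 * f) - Pi.post NR f κ h P) +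
          if (Pi.idx P h).Nonempty then 2 * f else 0 := by
      intro P
      split_ifs with hi
      · have h1 : Pi.post NR f κ h P ^ 2 / (2 * f) - Pi.post NR f κ h P + 2 * f -
            Pi.post NR f κ h P = (Pi.post NR f κ h P - 2 * f) ^ 2 / (2 * f) := by
          have := hf.1.ne'
          field_simp
          ring
        have h2 : 0 ≤ (Pi.post NR f κ h P - 2 * f) ^ 2 / (2 * f) :=
          div_nonneg (sq_nonneg _) (by linarith [hf.1])
        linarith
      · have h0 : Pi.post NR f κ h P = 0 := by
          refine post_eq_zero fun i hil hc => hi ⟨i, ?_⟩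
          exact Finset.mem_filter.2 ⟨Finset.mem_range.2 (hl ▸ hil), hc⟩
        simp [h0]
    have hsum := Finset.sum_le_sum fun P (_ : P ∈ Finset.univ.erase NR) => hpt P
    rw [Finset.sum_add_distrib, ← Finset.sum_filter, Finset.sum_const, nsmul_eq_mul] at hsum
    rw [← Finset.add_sum_erase _ _ (Finset.mem_univ NR)]
    have hNR := (post_mem_Icc (Pi := Pi) (NR := NR) (κ := κ) hf h NR).2
    have hY := mul_le_mul_of_nonneg_left (Pi.value_mem_Icc h).2 hc
    have hU' : (U.card : ℝ) ≤ n := by exact_mod_cast hUn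
    have h3 := mul_le_mul_of_nonneg_right (hcard.trans (add_le_add_left hU' _))
      (by linarith [hf.1] : 0 ≤ 2 * f)
    have h4 : (n + Pi.varSum NR h / β) * (2 * f) = 2 * f * n + d * Pi.varSum NR h := by
      rw [hd]
      ring
    linarith

end Protocol

/-! ### The attack with general parameters -/

namespace Protocol

variable {M : Type*} {t l : ℕ} {Pi : Protocol M t l} {NR : Fin t} {f κ : ℝ}

theorem Reachable.mem_transcript {h : List M} (hr : Pi.Reachable h) (hl : h.length = l) :
    h ∈ Pi.transcript.support := by
  obtain ⟨w, hw, hwh⟩ := hr.exists_transcript hl.le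
  obtain ⟨s, rfl, hs⟩ := exists_of_mem_support_extend hw
  rw [List.take_of_length_le (by omega)] at hwh
  exact hwh ▸ hw

theorem one_sub_loss_le_expectation (hf : 0 < f ∧ f ≤ 1) {k : ℕ} (hk : 0 < k) :
    1 - Pi.loss NR f κ k l [] ∅ ≤ (Pi.attack NR f κ k).expectation := by
  have h := ex_run_attack_le (Pi := Pi) (NR := NR) (κ := κ) hf hk l [] ∅ (by simp [corrupted_nil])
  have h0 : ∀ w : View M, 0 ≤ (if Pi.outcome w.history = true then (0 : ℝ) else 1) ∧
      (if Pi.outcome w.history = true then (0 : ℝ) else 1) ≤ 1 := fun w => by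
    split_ifs <;> simp
  have he : (Pi.attack NR f κ k).expectation =
      1 - ex ((Pi.attack NR f κ k).run l []) fun w =>
        if Pi.outcome w.history = true then (0 : ℝ) else 1 := by
    have h1 : (Pi.attack NR f κ k).expectation = ex ((Pi.attack NR f κ k).run l []) fun w =>
        if Pi.outcome w.history = true then (1 : ℝ) else 0 := by
      rw [Adversary.expectation, pr_eq_ex, Adversary.execution]
      refine ex_congr fun w _ => ?_
      simp only [Set.mem_ofPred_eq]
      congr
    rw [h1, eq_sub_iff_add_eq,
      ← ex_add (Bdd.of_mem_Icc (C := 1) fun w => ite_mem_Icc _) (Bdd.of_mem_Icc h0)]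
    refine (ex_congr fun w _ => ?_).trans (ex_const _ 1)
    split_ifs <;> norm_num
  rw [he]
  exact sub_le_sub_left h 1

theorem prodWeight_zero (S : Finset (Fin t)) :
    prodWeight (fun _ => 0) S = if S = ∅ then 1 else 0 := by
  split_ifs with h
  · simp [prodWeight, h]
  · obtain ⟨P, hP⟩ := Finset.nonempty_iff_ne_empty.2 h
    exact Finset.prod_eq_zero (Finset.mem_univ P) (if_pos hP)

theorem potential_nil (d c e k : ℝ) : Pi.potential NR f κ d c e k [] =
    Real.exp (-κ * Pi.expectation) + (e - c * Pi.expectation) / k := by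
  rw [potential, varSum, expectation]
  simp [post_nil]
  ring

/-- The quantitative form of the attack, for arbitrary values of the parameters. -/
theorem le_expectation_attack (hf : 0 < f ∧ f ≤ 1) (hκ : 0 < κ) {n : ℕ} {a β d c e : ℝ}
    (hβ : 0 < β) (hc : c * κ = κ ^ 2 / f + d) (hd : d = 2 * f / β)
    (he : e = 1 + 2 * f * n + c) (ha : κ * a ≤ f / 2) {k : ℕ} (hk : 0 < k)
    (hjump : ∀ h, Pi.Reachable h → h.length < l → Pi.party h ≠ NR →
      ∀ m ∈ (Pi.msg h).support, -a < Pi.jump h m)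
    (hvar : ∀ h ∈ Pi.transcript.support, ∃ U : Finset (Fin t), U.card ≤ n ∧
      ∀ P ≠ NR, (Pi.idx P h).Nonempty → P ∉ U → β ≤ Pi.totalVar P h) :
    1 - (Real.exp (-κ * Pi.expectation) + e / k) ≤ (Pi.attack NR f κ k).expectation := by
  have hk' : (0 : ℝ) < k := by exact_mod_cast hk
  have hc0 : 0 ≤ c := by
    have h1 : 0 ≤ c * κ := by
      have := hf.1
      rw [hc, hd]
      positivity
    exact nonneg_of_mul_nonneg_left h1 hκ
  have h := sum_loss_le (Pi := Pi) (NR := NR) (κ := κ) hf k (Pi.potential NR f κ d c e k)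
    (fun h hr hl => by
      obtain ⟨U, hUn, hU⟩ := hvar h (hr.mem_transcript hl)
      exact cost_le_potential hf hβ hk' hc0 hd he hl hUn hU)
    (fun h _ _ => bdd_potential hf hκ d c e k h _)
    (fun h hr hl => by
      by_cases hp : Pi.party h = NR
      · exact potential_le_of_special hκ hc0 hk' hl hp
      · exact potential_le_of_ordinary hf hκ hc hk' ha hl hp (hjump h hr hl hp))
    l [] Pi.reachable_nil (by simp)
  simp only [post_nil, prodWeight_zero, ite_mul, one_mul, zero_mul, Finset.sum_ite_eq',
    Finset.mem_univ, if_true] at h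
  rw [potential_nil] at h
  have h2 : (e - c * Pi.expectation) / k ≤ e / k := by
    gcongr
    exact sub_le_self _ (mul_nonneg hc0 (Pi.value_mem_Icc []).1)
  have h3 := one_sub_loss_le_expectation (Pi := Pi) (NR := NR) (κ := κ) hf hk
  linarith

end Protocol

/-! ### Choice of the parameters -/

theorem logb_two_le_sub_one {s : ℝ} (hs : 2 ≤ s) : Real.logb 2 s ≤ s - 1 := by
  rw [Real.logb_le_iff_le_rpow one_lt_two (by linarith)]
  have := one_add_mul_self_le_rpow_one_add (s := 1) (by norm_num) (p := s - 1) (by linarith)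
  norm_num at this
  linarith

/-- The size of the parameters, in terms of `y = 1 / eps n`. -/
theorem exists_inv_eps {n : ℕ} (hn : 3 ≤ n) (h1 : eps n ≤ 1) :
    ∃ y : ℝ, 1 ≤ y ∧ eps n = 1 / y ∧ lam n = 100 * y ^ 5 ∧ y ^ 6 ≤ Real.logb 2 n ∧
      y ^ 2 ≤ Real.sqrt n ∧ 2 ≤ Real.logb 2 n ∧ 2 ≤ Real.sqrt n := by
  have hn3 : (3 : ℝ) ≤ n := by exact_mod_cast hn
  set L := Real.logb 2 (n : ℝ) with hL
  have hL1 : 1 < L := by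
    rw [hL, Real.lt_logb_iff_rpow_lt one_lt_two (by linarith)]
    norm_num
    linarith
  set x := Real.logb 2 L with hx
  have hx0 : 0 < x := Real.logb_pos one_lt_two hL1
  set y := x ^ (1 / 50 : ℝ) with hy
  have hy0 : 0 < y := Real.rpow_pos_of_pos hx0 _
  have heps : eps n = 1 / y := rfl
  have hy1 : 1 ≤ y := by
    rw [heps, div_le_one hy0] at h1
    exact h1
  have hyx : y ^ 50 = x := by
    rw [hy, ← Real.rpow_natCast, ← Real.rpow_mul hx0.le]
    norm_num
  have hx1 : 1 ≤ x := hyx ▸ one_le_pow₀ hy1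
  have hL2 : 2 ≤ L := by
    have := (Real.le_logb_iff_rpow_le one_lt_two (by linarith)).1 hx1
    simpa using this
  have hn4 : (4 : ℝ) ≤ n := by
    have := (Real.le_logb_iff_rpow_le one_lt_two (by linarith)).1 hL2
    norm_num at this
    exact_mod_cast this
  set s := Real.sqrt n with hs
  have hs2 : 2 ≤ s := Real.le_sqrt_of_sq_le (by linarith)
  have hLs : L = 2 * Real.logb 2 s := by
    rw [hL, ← Real.sq_sqrt (by linarith : (0 : ℝ) ≤ n), Real.logb_pow]
    norm_num
    rw [← hs]
  -- From `L = 2 * logb 2 s ≤ 2 * s` follows `logb 2 L ≤ 1 + logb 2 s ≤ s`.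
  have hxs : x ≤ s := by
    have h3 : Real.logb 2 s ≤ s - 1 := logb_two_le_sub_one hs2
    have h4 : x ≤ Real.logb 2 (2 * s) := by
      rw [hx]
      exact Real.logb_le_logb_of_le one_lt_two (by linarith) (by linarith)
    rw [Real.logb_mul (by norm_num) (by linarith), Real.logb_self_eq_one one_lt_two] at h4
    linarith
  refine ⟨y, hy1, heps, ?_, ?_, ?_, hL2, hs2⟩
  · rw [lam, heps]
    field_simp
  · have : y ^ 6 ≤ y ^ 50 := pow_le_pow_right₀ hy1 (by norm_num)
    have h3 : x ≤ L - 1 := logb_two_le_sub_one hL2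
    linarith
  · have : y ^ 2 ≤ y ^ 50 := pow_le_pow_right₀ hy1 (by norm_num)
    linarith

end CoinFlip

/-- Biasing normal coin-flipping protocols. -/
theorem mainTheorem3 :
    ∃ C₁ C₂ : ℝ, 0 < C₁ ∧ 0 < C₂ ∧
      ∀ (n : ℕ), 3 ≤ n →
      ∀ (M : Type*) (t l : ℕ) (Pi : CoinFlip.Protocol M t l) (NR : Fin t),
        Pi.IsNormal n NR →
        CoinFlip.eps n ≤ Pi.expectation →
        CoinFlip.pr Pi.transcript {w | (Pi.idx NR w).Nonempty} ≤ CoinFlip.del n →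
        ∃ (k : ℕ) (A : CoinFlip.Adversary Pi),
          (k : ℝ) ≤ C₁ * (Real.sqrt n * Real.logb 2 n) ∧
          A.IsAdaptive k ∧
          1 - C₂ * CoinFlip.eps n ≤ A.expectation := by
  -- The factor `2` absorbs rounding up the budget; `205 = 204 + 1` adds the corruption cost and the
  -- exponential term.
  refine ⟨2, 205, by norm_num, by norm_num, fun n hn M t l Pi NR hN hE _ => ?_⟩
  -- An expectation is at most `1`, so `eps n ≤ 1`; this excludes the `n` with `log log n < 1`.
  obtain ⟨y, hy1, heps, hlam, hy6, hy2, hL, hs⟩ :=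
    CoinFlip.exists_inv_eps hn (hE.trans (Pi.value_mem_Icc []).2)
  set L := Real.logb 2 (n : ℝ)
  set s := Real.sqrt n with hsd
  have hn0 : (0 : ℝ) < n := by exact_mod_cast (by omega : 0 < n)
  have hss : s * s = n := Real.mul_self_sqrt hn0.le
  have hs0 : 0 < s := by linarith
  have hy0 : 0 < y := by linarith
  have hsL : 4 ≤ s * L := by nlinarith
  have hk : 0 < ⌈s * L⌉₊ := Nat.ceil_pos.2 (by linarith)
  -- With `κ = y ^ 2` the exponent `κ * eps n` equals `y`. With `f = κ / s` the requirement `κ * a ≤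
  -- f / 2` becomes `2 ≤ lam n`, and the balance forces `c = κ / f + d / κ = s + 2 * lam n * s`.
  refine ⟨⌈s * L⌉₊, Pi.attack NR (y ^ 2 / s) (y ^ 2) ⌈s * L⌉₊, ?_,
    CoinFlip.Protocol.isAdaptive_attack _, ?_⟩
  · linarith [Nat.ceil_lt_add_one (by linarith : 0 ≤ s * L)]
  have hl0 : 0 < CoinFlip.lam n := by rw [hlam]; positivity
  have hl100 : 100 ≤ CoinFlip.lam n := by
    rw [hlam]
    linarith [one_le_pow₀ hy1 (n := 5)]
  have key := CoinFlip.Protocol.le_expectation_attack (Pi := Pi) (NR := NR) (f := y ^ 2 / s)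
    (κ := y ^ 2) (n := n) (a := 1 / (CoinFlip.lam n * s)) (β := 1 / (CoinFlip.lam n * n))
    (d := 2 * (y ^ 2 / s) / (1 / (CoinFlip.lam n * n))) (c := s + 2 * CoinFlip.lam n * s)
    (e := 1 + 2 * (y ^ 2 / s) * n + (s + 2 * CoinFlip.lam n * s))
    ⟨by positivity, (div_le_one hs0).2 hy2⟩ (by positivity) (by positivity)
    (by rw [← hss]; field_simp) rfl rfl
    (by
      rw [div_div, mul_one_div]
      exact div_le_div_of_nonneg_left (by positivity) (by positivity) (by nlinarith)) hk
    (fun h hr hlt hp m hm => hN.neg_lt_jump hr hlt hp hm) (fun h hh => hN.exists_unfulfilled hh)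
  refine le_trans ?_ key
  -- `204 = 1 + 2 + 1 + 200`, one number for each summand, the last from `2 * lam n = 200 * y ^ 5`.
  -- Dividing by a budget of at least `s * y ^ 6` leaves `204 / y`.
  have he : 1 + 2 * (y ^ 2 / s) * n + (s + 2 * CoinFlip.lam n * s) ≤ 204 * y ^ 5 * s := by
    have h1 : 2 * (y ^ 2 / s) * n = 2 * y ^ 2 * s := by
      rw [← hss]
      field_simp
    have h2 : y ^ 2 ≤ y ^ 5 := pow_le_pow_right₀ hy1 (by norm_num)
    have h3 : 1 ≤ y ^ 5 := one_le_pow₀ hy1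
    rw [h1, hlam]
    nlinarith [mul_le_mul_of_nonneg_right h2 hs0.le, mul_le_mul_of_nonneg_right h3 hs0.le]
  have hfrac : (1 + 2 * (y ^ 2 / s) * n + (s + 2 * CoinFlip.lam n * s)) / (⌈s * L⌉₊ : ℝ) ≤
      204 * (1 / y) := by
    rw [div_le_iff₀ (by exact_mod_cast hk)]
    refine he.trans ?_
    have h4 : s * y ^ 6 ≤ ⌈s * L⌉₊ :=
      (mul_le_mul_of_nonneg_left hy6 hs0.le).trans (Nat.le_ceil _)
    calc 204 * y ^ 5 * s = 204 * (1 / y) * (s * y ^ 6) := by field_simp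
      _ ≤ 204 * (1 / y) * ⌈s * L⌉₊ := by gcongr
  have hexp : Real.exp (-y ^ 2 * Pi.expectation) ≤ 1 / y := by
    have h5 : -y ^ 2 * Pi.expectation ≤ -y := by
      have h6 : y = y ^ 2 * CoinFlip.eps n := by
        rw [heps]
        field_simp
      have h7 := mul_le_mul_of_nonneg_left hE (sq_nonneg y)
      linarith
    refine (Real.exp_le_exp.2 h5).trans ?_
    rw [Real.exp_neg, ← one_div]
    gcongr
    linarith [Real.add_one_le_exp y]
  rw [heps]
  linarith
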